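/- Let $\mathcal A$ be a finite alphabet with $d\ge 2$ letters. Let $\pi=(\pi_0,\pi_1)$ be a pair of bijections $\mathcal A\to\{1,\dots,d\}$ that is irreducible, i.e. $\pi_1\circ\pi_0^{-1}\{1,\dots,k\}=\{1,\dots,k\}$ with $1\le k\le d$ only for $k=d$. Let $$\Theta_\pi=\Big\{\tau\in\mathbb R^{\mathcal A} : \sum_{\pi_0(\alpha)\le j}\tau_\alpha>0>\sum_{\pi_1(\alpha)\le j}\tau_\alpha\ \text{ for all } 1\le j<d\Big\},$$ with the supremum metric, and let $B_{\Theta_\pi}(\tilde\tau,\epsilon)$ denote balls in it. For $\lambda\in\mathbb R_{>0}^{\mathcal A}$ put $|\lambda|=\sum_\alpha\lambda_\alpha$ and $I=[0,|\lambda|)$, so that $|I|=|\lambda|$, and let $T=(\pi,\lambda):I\to I$ be the interval exchange transformation with intervals $I_\alpha=\big[\sum_{\pi_0(\beta)<\pi_0(\alpha)}\lambda_\beta,\ \sum_{\pi_0(\beta)\le\pi_0(\alpha)}\lambda_\beta\big)$, which acts on $I_\alpha$ as the translation by $\sum_{\pi_1(\beta)<\pi_1(\alpha)}\lambda_\beta-\sum_{\pi_0(\beta)<\pi_0(\alpha)}\lambda_\beta$.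 Rauzy–Veech induction $R(\pi,\lambda,\tau)=(\pi^{(1)},\lambda^{(1)},\tau^{(1)})$ is defined when $\lambda_a\ne\lambda_b$, where $a=\pi_0^{-1}(d)$ and $b=\pi_1^{-1}(d)$. If $\lambda_a>\lambda_b$ (the winner is $w=a$, the loser is $l=b$), then the letter $l$ is moved in the bottom row $\pi_1$ to the place directly after $w$; if $\lambda_a<\lambda_b$ (then $w=b$, $l=a$), then $l$ is moved in the top row $\pi_0$ to the place directly after $w$. In both cases $\lambda^{(1)}_w=\lambda_w-\lambda_l$, $\tau^{(1)}_w=\tau_w-\tau_l$, and all other coordinates of $\lambda$ and $\tau$ are unchanged. Write $R^n(\pi,\lambda,\tau)=(\pi^{(n)},\lambda^{(n)},\tau^{(n)})$, let $I^{(n)}=[0,|\lambda^{(n)}|)$, let $I^{(n)}_\alpha$ (of length $\lambda^{(n)}_\alpha$) be the intervals exchanged by $(\pi^{(n)},\lambda^{(n)})$, and let $q^{(n)}_\alpha$ be the first return time of $I_\alpha^{(n)}$ to $I^{(n)}$ under $T$. The Rauzy–Veech renormalization is $\mathcal R(\pi,\lambda,\tau)=\big(\pi^{(1)},\lambda^{(1)}/|\lambda^{(1)}|,|\lambda^{(1)}|\,\tau^{(1)}\big)$.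 **Proposition.** Let $\tilde\tau\in\Theta_\pi$ be rationally independent, i.e. its coordinates are linearly independent over $\mathbb Q$. There exist $\epsilon>0$ and $C>0$, depending only on $\pi$ and $\tilde\tau$, such that for every $\lambda\in\mathbb R^{\mathcal A}_{>0}$, every $\tau\in\Theta_\pi$ and every $n\ge 0$ the following holds. If $\mathcal R^n(\pi,\lambda,\tau)$ is defined and belongs to $\{\pi\}\times\mathbb R^{\mathcal A}_{>0}\times B_{\Theta_\pi}(\tilde\tau,\epsilon)$, then for every $\alpha\in\mathcal A$ every interval $J\subseteq I\setminus\bigsqcup_{i=0}^{q^{(n)}_\alpha-1}T^iI^{(n)}_\alpha$ satisfies $$|J|<C\cdot\max_{\beta\in\mathcal A\setminus\{\alpha\}}|I^{(n)}_\beta|,$$ and $$\max\Big\{\min_{0\le i<q^{(n)}_\alpha}\operatorname{dist}\big(0,T^i(I^{(n)}_\alpha)\big),\ \min_{0\le i<q^{(n)}_\alpha}\operatorname{dist}\big(|I|,T^i(I^{(n)}_\alpha)\big)\Big\}<C\cdot\max_{\beta\in\mathcal A\setminus\{\alpha\}}|I^{(n)}_\beta|.$$ -/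

import Mathlib

noncomputable section

namespace IETSpacing

/-- Combinatorial data of an interval exchange transformation on the alphabet `A`: a pair of
bijections onto the `d = |A|` positions. Positions are numbered `0, …, d - 1`. -/
structure PermPair (A : Type*) [Fintype A] where
  top : A ≃ Fin (Fintype.card A)
  bot : A ≃ Fin (Fintype.card A)

/-- `π₁ ∘ π₀⁻¹` preserves the set of the first `k ≥ 1` positions only for `k = d`. -/
def PermPair.Irreducible {A : Type*} [Fintype A] (p : PermPair A) : Prop :=
  ∀ k : ℕ, 1 ≤ k → k ≤ Fintype.card A →
    (fun j : Fin (Fintype.card A) => p.bot (p.top.symm j)) '' {j : Fin (Fintype.card A) | j.val < k} =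
      {j : Fin (Fintype.card A) | j.val < k} →
    k = Fintype.card A

/-- The last position, `d - 1`. -/
def lastPos (A : Type*) [Fintype A] [Nonempty A] : Fin (Fintype.card A) :=
  ⟨Fintype.card A - 1, Nat.sub_lt Fintype.card_pos Nat.one_pos⟩

/-- The letter `π₀⁻¹(d)`. -/
def PermPair.topLast {A : Type*} [Fintype A] [Nonempty A] (p : PermPair A) : A :=
  p.top.symm (lastPos A)

/-- The letter `π₁⁻¹(d)`. -/
def PermPair.botLast {A : Type*} [Fintype A] [Nonempty A] (p : PermPair A) : A :=
  p.bot.symm (lastPos A)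

/-- The matrix `Ω_π`. -/
def omegaMatrix {A : Type*} [Fintype A] (p : PermPair A) : Matrix A A ℝ :=
  Matrix.of fun a b =>
    if p.bot b < p.bot a ∧ p.top a < p.top b then 1
    else if p.bot a < p.bot b ∧ p.top b < p.top a then -1
    else 0

/-- The left endpoint `l_a` of the exchanged interval with label `a`. -/
def leftEnd {A : Type*} [Fintype A] (p : PermPair A) (lam : A → ℝ) (a : A) : ℝ :=
  ∑ b with p.top b < p.top a, lam b

/-- The exchanged interval `I_a = [l_a, r_a)`, of length `lam a`. -/
def exchInterval {A : Type*} [Fintype A] (p : PermPair A) (lam : A → ℝ) (a : A) : Set ℝ :=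
  Set.Ico (leftEnd p lam a) (∑ b with p.top b ≤ p.top a, lam b)

/-- The domain `I = [0, |lam|)`. -/
def baseInterval {A : Type*} [Fintype A] (lam : A → ℝ) : Set ℝ :=
  Set.Ico 0 (∑ a, lam a)

open Classical in
/-- The interval exchange transformation `(π, lam)`: `T x = x + w_a` on `I_a`, where
`w = Ω_π lam`. It is extended by the identity outside `I`. -/
def iet {A : Type*} [Fintype A] (p : PermPair A) (lam : A → ℝ) (x : ℝ) : ℝ :=
  x + ∑ a, if x ∈ exchInterval p lam a then (omegaMatrix p).mulVec lam a else 0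

/-- The cone `Θ_π` of suspension data. -/
def Theta {A : Type*} [Fintype A] (p : PermPair A) : Set (A → ℝ) :=
  {tau | ∀ j : ℕ, 1 ≤ j → j < Fintype.card A →
    0 < ∑ a with (p.top a : ℕ) < j, tau a ∧ ∑ a with (p.bot a : ℕ) < j, tau a < 0}

/-- The map of positions that moves the last position to the place directly after `k`, shifts
the positions strictly between `k` and the last one by one to the right, and fixes the others. -/
def moveLastFun {d : ℕ} (k p : Fin d) : Fin d :=
  if h : k < p then
    if hp : (p : ℕ) + 1 < d then ⟨p + 1, hp⟩ else ⟨k + 1, lt_of_le_of_lt h p.isLt⟩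
  else p

theorem moveLastFun_injective {d : ℕ} (k : Fin d) : Function.Injective (moveLastFun k) := by
  intro p q h
  have hp := p.isLt
  have hq := q.isLt
  unfold moveLastFun at h
  simp only [Fin.lt_def] at h
  split_ifs at h <;> simp only [Fin.ext_iff] at h ⊢ <;> omega

/-- `moveLastFun` as a permutation of the positions. -/
def moveLast {d : ℕ} (k : Fin d) : Equiv.Perm (Fin d) :=
  Equiv.ofBijective (moveLastFun k) (Finite.injective_iff_bijective.mp (moveLastFun_injective k))

/-- The data `(π, λ, τ)` of a polygonal translation surface. -/
structure SurfaceData (A : Type*) [Fintype A] where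
  perm : PermPair A
  lam : A → ℝ
  tau : A → ℝ

/-- One step of Rauzy-Veech induction is defined: the two last intervals (top and bottom row)
have different lengths. -/
def SurfaceData.Inducible {A : Type*} [Fintype A] [Nonempty A] (s : SurfaceData A) : Prop :=
  s.lam s.perm.topLast ≠ s.lam s.perm.botLast

/-- The elementary matrix `B(1)` of one step with given winner and loser. -/
def stepMatrix {A : Type*} [DecidableEq A] (winner loser : A) : Matrix A A ℝ :=
  1 + Matrix.single loser winner 1

/-- The row vector `v B(1)⁻¹`. -/
def reduceVec {A : Type*} [DecidableEq A] (winner loser : A) (v : A → ℝ) : A → ℝ :=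
  Function.update v winner (v winner - v loser)

theorem reduceVec_vecMul_stepMatrix {A : Type*} [Fintype A] [DecidableEq A] {winner loser : A}
    (h : loser ≠ winner) (v : A → ℝ) :
    Matrix.vecMul (reduceVec winner loser v) (stepMatrix winner loser) = v := by
  ext a
  rw [stepMatrix, Matrix.vecMul_add, Matrix.vecMul_one]
  by_cases ha : a = winner
  · subst ha
    simp [reduceVec, Matrix.vecMul, dotProduct, Matrix.single_apply, h]
  · simp [reduceVec, Matrix.vecMul, dotProduct, ha, Ne.symm ha]

/-- One step `R` of (two-dimensional) Rauzy-Veech induction, meaningful on inducible data: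
`T` is induced on `[0, |λ| - min(λ_{π₀⁻¹(d)}, λ_{π₁⁻¹(d)}))`. In the top type the letter
`π₀⁻¹(d)` wins, and the loser `π₁⁻¹(d)` is moved in the bottom row to the place directly after
the winner; in the bottom type the roles of the two rows are exchanged. -/
def rauzyVeech {A : Type*} [Fintype A] [DecidableEq A] [Nonempty A]
    (s : SurfaceData A) : SurfaceData A :=
  let t := s.perm.topLast
  let b := s.perm.botLast
  if s.lam b < s.lam t then
    { perm := ⟨s.perm.top, s.perm.bot.trans (moveLast (s.perm.bot t))⟩
      lam := reduceVec t b s.lam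
      tau := reduceVec t b s.tau }
  else
    { perm := ⟨s.perm.top.trans (moveLast (s.perm.top b)), s.perm.bot⟩
      lam := reduceVec b t s.lam
      tau := reduceVec b t s.tau }

/-- The Rauzy-Veech renormalization
`(π, λ, τ) ↦ (π⁽¹⁾, λ⁽¹⁾ / |λ⁽¹⁾|, |λ⁽¹⁾| τ⁽¹⁾)`. -/
def renorm {A : Type*} [Fintype A] [DecidableEq A] [Nonempty A]
    (s : SurfaceData A) : SurfaceData A :=
  let s' := rauzyVeech s
  { perm := s'.perm
    lam := (∑ a, s'.lam a)⁻¹ • s'.lam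
    tau := (∑ a, s'.lam a) • s'.tau }

/-- The `n`-th iterate of Rauzy-Veech induction (equivalently, of the renormalization, which
only rescales) is defined at `s`. -/
def IterDefined {A : Type*} [Fintype A] [DecidableEq A] [Nonempty A]
    (n : ℕ) (s : SurfaceData A) : Prop :=
  ∀ k < n, (rauzyVeech^[k] s).Inducible

/-- The interval `I_a⁽ⁿ⁾` exchanged by the `n`-th induced transformation. -/
def towerBase {A : Type*} [Fintype A] [DecidableEq A] [Nonempty A]
    (n : ℕ) (s : SurfaceData A) (a : A) : Set ℝ :=
  exchInterval (rauzyVeech^[n] s).perm (rauzyVeech^[n] s).lam a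

/-- The height `q_a⁽ⁿ⁾`: the first return time of the interval `I_a⁽ⁿ⁾` to `I⁽ⁿ⁾` under `T`. -/
def towerHeight {A : Type*} [Fintype A] [DecidableEq A] [Nonempty A]
    (n : ℕ) (s : SurfaceData A) (a : A) : ℕ :=
  sInf {k : ℕ | 0 < k ∧
    (iet s.perm s.lam)^[k] '' towerBase n s a ⊆ baseInterval (rauzyVeech^[n] s).lam}

/-- The level `T^i I_a⁽ⁿ⁾`. -/
def towerLevel {A : Type*} [Fintype A] [DecidableEq A] [Nonempty A]
    (n : ℕ) (s : SurfaceData A) (a : A) (i : ℕ) : Set ℝ :=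
  (iet s.perm s.lam)^[i] '' towerBase n s a

/-- `max_{b ≠ a} |I_b⁽ⁿ⁾|`. -/
def maxOther {A : Type*} [Fintype A] [DecidableEq A] [Nonempty A]
    (n : ℕ) (s : SurfaceData A) (a : A) : ℝ :=
  ⨆ b : {b : A // b ≠ a}, (rauzyVeech^[n] s).lam b

end IETSpacing

end

/-! ### Partial sums of the rows, heights, and the cone `Theta` under one step -/

noncomputable section

namespace IETSpacing

variable {A : Type*} [Fintype A]

/-! A Rauzy–Veech step can be undone from `(π, τ)` alone: the sign of the total of `τ` tells whether
the top or the bottom letter has won. Hence the last `m` steps before time `n`, and the substitution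
by which they subdivide the tower levels, depend only on `π⁽ⁿ⁾` and `τ⁽ⁿ⁾`, not on `λ`. They are
decided by finitely many signs of nonzero sums, so they are constant near a rationally independent
vector (`eventually_backWord_eq`).

For such a vector the substitution of some number `m` of steps is positive: each of its words
contains every letter (`exists_backWord_full`). The tower levels, listed from left to right, form a
word, and for `n ≥ m` this word is a concatenation of substitution words of length at most `2 ^ m`
(`exists_isTower`). So at most `2 * 2 ^ m` consecutive levels avoid a given letter `α`, each no
longer than the longest interval with another label. For `n ≤ m` the whole list of levels is bounded
in length. This gives both estimates (`IsTower.spacing`).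

Positivity follows once every letter wins infinitely often in the backward orbit
(`IsBackOrbit.frequently_backWinner_eq`). A backward step subtracts the height of the winner from
that of the loser, and heights stay positive, so the heights of the winners tend to `0`. If some
letters won only finitely often, their coordinates would eventually be frozen, while the heights of
all other letters would tend to `0`. At a suitable time this makes the sum over some block of frozen
letters arbitrarily small, although the finitely many nonempty sums of frozen independent
coordinates are bounded away from `0`. -/

/-- The sum of `v` over the letters strictly to the left of `c` in the row `r`. -/
def rowSum (r : A ≃ Fin (Fintype.card A)) (v : A → ℝ) (c : A) : ℝ :=
  ∑ b with r b < r c, v b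

/-- The first return height of the zippered rectangle over `c`, for suspension data `v`. -/
def height (p : PermPair A) (v : A → ℝ) (c : A) : ℝ :=
  rowSum p.top v c - rowSum p.bot v c

theorem rowSum_neg (r : A ≃ Fin (Fintype.card A)) (v : A → ℝ) (c : A) :
    rowSum r (-v) c = -rowSum r v c := by
  simp [rowSum]

theorem rowSum_add_self_of_last {r : A ≃ Fin (Fintype.card A)} {l : A}
    (hl : (r l : ℕ) + 1 = Fintype.card A) (v : A → ℝ) :
    rowSum r v l + v l = ∑ a, v a := by
  classical
  rw [rowSum, Finset.sum_filter, Fintype.sum_eq_add_sum_compl l v, add_comm,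
    ← Finset.sum_filter_add_sum_filter_not Finset.univ (fun b => b = l)]
  have h1 : ∀ b, b ≠ l → r b < r l := by
    intro b hb
    have : r b ≠ r l := fun h => hb (r.injective h)
    have h2 := (r b).isLt
    rw [Fin.lt_def]
    have : (r b : ℕ) ≠ r l := fun h => this (Fin.ext h)
    omega
  have h2 : (∑ x with x = l, if r x < r l then v x else 0) = 0 := by
    apply Finset.sum_eq_zero
    intro x hx
    simp at hx
    simp [hx]
  rw [h2, zero_add]
  congr 1
  apply Finset.sum_congr
  · ext; simp
  · intro b hb
    simp at hb
    simp [h1 b hb]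

/-- `rowSum` at the letter following `c` in the row. -/
theorem rowSum_add_self_of_succ {r : A ≃ Fin (Fintype.card A)} {c e : A}
    (h : (r e : ℕ) = r c + 1) (v : A → ℝ) : rowSum r v e = rowSum r v c + v c := by
  classical
  have : Finset.univ.filter (fun b => r b < r e)
      = insert c (Finset.univ.filter fun b => r b < r c) := by
    ext b
    simp only [Finset.mem_filter, Finset.mem_univ, true_and, Finset.mem_insert, Fin.lt_def]
    constructor
    · intro hb
      by_cases hbc : b = c
      · exact Or.inl hbc
      · right
        have : (r b : ℕ) ≠ r c := fun h => hbc (r.injective (Fin.ext h))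
        omega
    · rintro (rfl | hb) <;> omega
  rw [rowSum, this, Finset.sum_insert (by simp), add_comm, rowSum]

theorem moveLast_val {d : ℕ} (k p : Fin d) :
    (moveLast k p : ℕ) =
      if (p : ℕ) ≤ k then (p : ℕ) else if (p : ℕ) + 1 < d then (p : ℕ) + 1 else k + 1 := by
  change ((moveLastFun k p : Fin d) : ℕ) = _
  unfold moveLastFun
  simp only [Fin.lt_def]
  split_ifs <;> first | rfl | (exfalso; omega)

theorem moveLast_self {d : ℕ} (k : Fin d) : moveLast k k = k := by
  apply Fin.ext
  simp [moveLast_val]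

theorem moveLast_val_eq_zero_iff {d : ℕ} (k p : Fin d) :
    (moveLast k p : ℕ) = 0 ↔ (p : ℕ) = 0 := by
  rw [moveLast_val]
  split_ifs <;> simp
  all_goals omega

theorem row_val_ne {r : A ≃ Fin (Fintype.card A)} {b c : A} (h : b ≠ c) : (r b : ℕ) ≠ r c :=
  fun e => h (r.injective (Fin.ext e))

section Move

variable [DecidableEq A] {r : A ≃ Fin (Fintype.card A)} {w l : A}

/-- Moving the last letter `l` directly after `w`, and reducing `v w` by `v l`, does not change
the partial sum to the left of any other letter. -/
theorem rowSum_move_of_ne (hl : (r l : ℕ) + 1 = Fintype.card A) (hwl : w ≠ l) (v : A → ℝ) {c : A}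
    (hc : c ≠ l) :
    rowSum (r.trans (moveLast (r w))) (reduceVec w l v) c = rowSum r v c := by
  have hw1 := row_val_ne (r := r) hwl
  have hc1 := row_val_ne (r := r) hc
  have hwlt := (r w).isLt
  have hclt := (r c).isLt
  have key : ∀ b, (if moveLast (r w) (r b) < moveLast (r w) (r c) then reduceVec w l v b else 0)
      = (if r b < r c then v b else 0) + (if b = l then (if r w < r c then v l else 0) else 0)
        - (if b = w then (if r w < r c then v l else 0) else 0) := by
    intro b
    have hblt := (r b).isLt
    by_cases hbl : b = l
    · subst hbl
      simp only [Fin.lt_def, moveLast_val, reduceVec, Function.update_of_ne hwl.symm,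
        if_neg hwl.symm, if_true]
      split_ifs <;> first | omega | simp
    · have hb1 := row_val_ne (r := r) hbl
      have : (moveLast (r w) (r b) < moveLast (r w) (r c)) ↔ r b < r c := by
        simp only [Fin.lt_def, moveLast_val]
        by_cases hbc : b = c
        · subst hbc; simp
        have hb2 := row_val_ne (r := r) hbc
        split_ifs <;> omega
      simp only [this, if_neg hbl, add_zero]
      by_cases hbw : b = w
      · subst hbw
        by_cases h : r b < r c <;> simp [h, reduceVec]
      · simp [hbw, reduceVec]
  simp only [rowSum, Finset.sum_filter]
  refine (Finset.sum_congr rfl fun b _ => ?_).trans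
    ((Finset.sum_congr rfl fun b _ => key b).trans ?_)
  · simp only [Equiv.trans_apply]
    congr
  simp [Finset.sum_add_distrib, Finset.sum_sub_distrib]

theorem rowSum_move_self (hl : (r l : ℕ) + 1 = Fintype.card A) (hwl : w ≠ l) (v : A → ℝ) :
    rowSum (r.trans (moveLast (r w))) (reduceVec w l v) l = rowSum r v w + v w - v l := by
  have hw1 := row_val_ne (r := r) hwl
  have hwlt := (r w).isLt
  have h : ((r.trans (moveLast (r w))) l : ℕ) = (r.trans (moveLast (r w))) w + 1 := by
    simp only [Equiv.trans_apply, moveLast_val]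
    split_ifs <;> omega
  rw [rowSum_add_self_of_succ h, rowSum_move_of_ne hl hwl v hwl]
  simp [reduceVec]
  ring

/-- The partial sums do not involve the last letter. -/
theorem rowSum_reduceVec_last (hw : (r w : ℕ) + 1 = Fintype.card A) (v : A → ℝ) (c : A) :
    rowSum r (reduceVec w l v) c = rowSum r v c := by
  apply Finset.sum_congr rfl
  intro b hb
  have : b ≠ w := by
    rintro rfl
    have := (r c).isLt
    simp only [Finset.mem_filter, Finset.mem_univ, true_and, Fin.lt_def] at hb
    omega
  simp [reduceVec, this]

end Move

theorem sum_reduceVec [DecidableEq A] {w l : A} (v : A → ℝ) :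
    ∑ a, reduceVec w l v a = ∑ a, v a - v l := by
  have : ∀ a, reduceVec w l v a = v a - if a = w then v l else 0 := by
    intro a
    by_cases h : a = w
    · subst h; simp [reduceVec]
    · simp [reduceVec, h]
  simp [this]

theorem PermPair.ext_rows {p p' : PermPair A} (h : p.top = p'.top) (h' : p.bot = p'.bot) :
    p = p' := by
  cases p; cases p'; simp_all

/-- Exchange of the two rows. -/
def PermPair.swap (p : PermPair A) : PermPair A := ⟨p.bot, p.top⟩

theorem PermPair.swap_swap (p : PermPair A) : p.swap.swap = p := rfl

theorem height_swap_neg (p : PermPair A) (v : A → ℝ) (c : A) :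
    height p.swap (-v) c = height p v c := by
  simp only [height, PermPair.swap, rowSum_neg]
  ring

theorem mem_Theta_iff {p : PermPair A} {v : A → ℝ} :
    v ∈ Theta p ↔ ∀ c, ((p.top c : ℕ) ≠ 0 → 0 < rowSum p.top v c) ∧
      ((p.bot c : ℕ) ≠ 0 → rowSum p.bot v c < 0) := by
  constructor
  · intro h c
    exact ⟨fun hc => (h (p.top c) (by omega) (p.top c).isLt).1,
      fun hc => (h (p.bot c) (by omega) (p.bot c).isLt).2⟩
  · intro h j hj hjd
    have h1 := (h (p.top.symm ⟨j, hjd⟩)).1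
    have h2 := (h (p.bot.symm ⟨j, hjd⟩)).2
    simp only [rowSum, Equiv.apply_symm_apply, Fin.lt_def] at h1 h2
    exact ⟨h1 (by omega), h2 (by omega)⟩

theorem neg_mem_Theta_swap {p : PermPair A} {v : A → ℝ} (h : v ∈ Theta p) :
    -v ∈ Theta p.swap := by
  rw [mem_Theta_iff] at h ⊢
  intro c
  simp only [PermPair.swap, rowSum_neg]
  exact ⟨fun hc => by linarith [(h c).2 hc], fun hc => by linarith [(h c).1 hc]⟩

theorem smul_mem_Theta {p : PermPair A} {v : A → ℝ} (h : v ∈ Theta p) {t : ℝ} (ht : 0 < t) :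
    t • v ∈ Theta p := by
  intro j hj hjd
  simp only [Pi.smul_apply, smul_eq_mul, ← Finset.mul_sum]
  exact ⟨mul_pos ht (h j hj hjd).1, mul_neg_of_pos_of_neg ht (h j hj hjd).2⟩

theorem rowSum_eq_zero {r : A ≃ Fin (Fintype.card A)} {c : A} (h : (r c : ℕ) = 0) (v : A → ℝ) :
    rowSum r v c = 0 := by
  rw [rowSum, Finset.filter_false_of_mem, Finset.sum_empty]
  intro b _
  simp only [Fin.lt_def]
  omega

theorem rowSum_nonneg_of_mem_Theta {p : PermPair A} {v : A → ℝ} (h : v ∈ Theta p) (c : A) :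
    0 ≤ rowSum p.top v c ∧ rowSum p.bot v c ≤ 0 := by
  have hc := mem_Theta_iff.1 h c
  constructor
  · by_cases h0 : (p.top c : ℕ) = 0
    · exact (rowSum_eq_zero h0 v).ge
    · exact (hc.1 h0).le
  · by_cases h0 : (p.bot c : ℕ) = 0
    · exact (rowSum_eq_zero h0 v).le
    · exact (hc.2 h0).le

variable [Nontrivial A]

theorem PermPair.top_topLast (p : PermPair A) : (p.top p.topLast : ℕ) + 1 = Fintype.card A := by
  have := Fintype.card_pos (α := A)
  simp [PermPair.topLast, lastPos]
  omega

theorem PermPair.bot_botLast (p : PermPair A) : (p.bot p.botLast : ℕ) + 1 = Fintype.card A :=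
  p.swap.top_topLast

/-- The partial sum up to and including a letter which is not the last one. -/
theorem rowSum_add_self_pos {p : PermPair A} {v : A → ℝ} (h : v ∈ Theta p) {c : A}
    (hc : c ≠ p.topLast) : 0 < rowSum p.top v c + v c := by
  have h1 := row_val_ne (r := p.top) hc
  have h2 := p.top_topLast
  have h3 := (p.top c).isLt
  have h4 : (p.top (p.top.symm ⟨p.top c + 1, by omega⟩) : ℕ) = p.top c + 1 := by simp
  rw [← rowSum_add_self_of_succ h4]
  exact (mem_Theta_iff.1 h _).1 (by omega)

theorem rowSum_add_self_neg {p : PermPair A} {v : A → ℝ} (h : v ∈ Theta p) {c : A}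
    (hc : c ≠ p.botLast) : rowSum p.bot v c + v c < 0 := by
  have := rowSum_add_self_pos (neg_mem_Theta_swap h) (c := c) hc
  simp only [PermPair.swap, rowSum_neg, Pi.neg_apply] at this
  linarith

/-- One of the two partial sums is strict unless `c` comes first in both rows. In that case `v c`
itself would have to be both positive and negative. -/
theorem height_pos {p : PermPair A} {v : A → ℝ} (h : v ∈ Theta p) (c : A) :
    0 < height p v c := by
  have h0 := rowSum_nonneg_of_mem_Theta h c
  have hc := mem_Theta_iff.1 h c
  unfold height
  by_cases h1 : (p.top c : ℕ) = 0
  · by_cases h2 : (p.bot c : ℕ) = 0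
    · exfalso
      have hcard := Fintype.one_lt_card (α := A)
      have e1 : c ≠ p.topLast := by
        rintro rfl
        have := p.top_topLast
        omega
      have e2 : c ≠ p.botLast := by
        rintro rfl
        have := p.bot_botLast
        omega
      have h3 := rowSum_add_self_pos h e1
      have h4 := rowSum_add_self_neg h e2
      have h5 : rowSum p.top v c = 0 := rowSum_eq_zero h1 v
      have h6 : rowSum p.bot v c = 0 := rowSum_eq_zero h2 v
      linarith
    · linarith [hc.2 h2]
  · linarith [hc.1 h1]

/-- For a letter that is last in both rows, both partial sums equal the total minus its coordinate,
so its height would vanish. -/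
theorem topLast_ne_botLast {p : PermPair A} {v : A → ℝ} (h : v ∈ Theta p) :
    p.topLast ≠ p.botLast := by
  intro e
  have h1 := rowSum_add_self_of_last p.top_topLast v
  have h2 := rowSum_add_self_of_last p.bot_botLast v
  have h3 := height_pos h p.topLast
  rw [← e] at h2
  unfold height at h3
  linarith

/-- The loser `botLast` is moved in the bottom row to the place directly after `topLast`. -/
def PermPair.topMove (p : PermPair A) : PermPair A :=
  ⟨p.top, p.bot.trans (moveLast (p.bot p.topLast))⟩

/-- The inverse of `topMove`. -/
def PermPair.topUnmove (p : PermPair A) : PermPair A :=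
  ⟨p.top, p.bot.trans (moveLast (p.bot p.topLast)).symm⟩

theorem PermPair.topLast_topMove (p : PermPair A) : p.topMove.topLast = p.topLast := rfl

theorem PermPair.topLast_topUnmove (p : PermPair A) : p.topUnmove.topLast = p.topLast := rfl

theorem PermPair.topUnmove_topMove (p : PermPair A) : p.topMove.topUnmove = p := by
  refine PermPair.ext_rows rfl ?_
  have : p.topMove.bot p.topLast = p.bot p.topLast := by simp [topMove, moveLast_self]
  ext c
  simp only [topUnmove, topLast_topMove, this, Equiv.trans_apply]
  simp [topMove]

theorem PermPair.bot_topUnmove_topLast (p : PermPair A) :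
    p.topUnmove.bot p.topLast = p.bot p.topLast := by
  simp [topUnmove, Equiv.symm_apply_eq, moveLast_self]

theorem PermPair.topMove_topUnmove (p : PermPair A) : p.topUnmove.topMove = p := by
  refine PermPair.ext_rows rfl ?_
  have := p.bot_topUnmove_topLast
  ext c
  simp only [topMove, topLast_topUnmove, this, Equiv.trans_apply]
  simp [topUnmove]

theorem height_topMove [DecidableEq A] {p : PermPair A} (hp : p.topLast ≠ p.botLast)
    (v : A → ℝ) (c : A) :
    height p.topMove (reduceVec p.topLast p.botLast v) c =
      height p v c + if c = p.botLast then height p v p.topLast else 0 := by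
  have h1 := rowSum_add_self_of_last p.top_topLast v
  have h2 := rowSum_add_self_of_last p.bot_botLast v
  unfold height
  simp only [PermPair.topMove]
  rw [rowSum_reduceVec_last p.top_topLast]
  split_ifs with hc
  · subst hc
    rw [rowSum_move_self p.bot_botLast hp]
    linarith
  · rw [rowSum_move_of_ne p.bot_botLast hp v hc]
    ring

/-- Only the bottom sum at the loser changes: it becomes its old value, which is at most `0`, minus
the positive height of the winner. -/
theorem reduceVec_mem_Theta_topMove [DecidableEq A] {p : PermPair A} {v : A → ℝ}
    (h : v ∈ Theta p) : reduceVec p.topLast p.botLast v ∈ Theta p.topMove := by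
  have hp := topLast_ne_botLast h
  have h1 := rowSum_add_self_of_last p.top_topLast v
  have h2 := rowSum_add_self_of_last p.bot_botLast v
  have h3 := height_pos h p.topLast
  have h4 := rowSum_nonneg_of_mem_Theta h p.botLast
  rw [mem_Theta_iff]
  intro c
  have hc := mem_Theta_iff.1 h c
  simp only [PermPair.topMove]
  rw [rowSum_reduceVec_last p.top_topLast]
  refine ⟨hc.1, fun h0 => ?_⟩
  simp only [Equiv.trans_apply, ne_eq, moveLast_val_eq_zero_iff] at h0
  by_cases hcl : c = p.botLast
  · subst hcl
    rw [rowSum_move_self p.bot_botLast hp]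
    unfold height at h3
    linarith
  · rw [rowSum_move_of_ne p.bot_botLast hp v hcl]
    exact hc.2 h0

/-- A converse of `reduceVec_mem_Theta_topMove`. -/
theorem mem_Theta_of_topMove [DecidableEq A] {p : PermPair A} {v : A → ℝ}
    (hp : p.topLast ≠ p.botLast) (h : reduceVec p.topLast p.botLast v ∈ Theta p.topMove)
    (hs : ∑ a, reduceVec p.topLast p.botLast v a < 0) : v ∈ Theta p := by
  rw [sum_reduceVec] at hs
  have h2 := rowSum_add_self_of_last p.bot_botLast v
  rw [mem_Theta_iff] at h ⊢
  intro c
  have hc := h c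
  simp only [PermPair.topMove, Equiv.trans_apply, ne_eq, moveLast_val_eq_zero_iff] at hc
  rw [rowSum_reduceVec_last p.top_topLast] at hc
  refine ⟨hc.1, fun h0 => ?_⟩
  by_cases hcl : c = p.botLast
  -- The total of the reduced data is the old bottom sum before the loser, so `hs` supplies the one
  -- inequality that the reduced data do not retain.
  · subst hcl
    linarith
  · rw [rowSum_move_of_ne p.bot_botLast hp v hcl] at hc
    exact hc.2 h0

end IETSpacing

end

/-! ### Backward Rauzy–Veech induction on suspension data -/

noncomputable section

namespace IETSpacing

variable {A : Type*} [Fintype A]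

theorem linearIndependent_update_add [DecidableEq A] {v : A → ℝ} (hv : LinearIndependent ℚ v)
    {w l : A} (hwl : w ≠ l) : LinearIndependent ℚ (Function.update v w (v w + v l)) := by
  rw [Fintype.linearIndependent_iff] at hv ⊢
  intro g hg
  have h1 : ∀ i, g i • Function.update v w (v w + v l) i
      = g i • v i + if i = w then g w • v l else 0 := by
    intro i
    by_cases h : i = w
    · subst h; simp
    · simp [h]
  have h2 : ∀ i, (Function.update g l (g l + g w)) i • v i
      = g i • v i + if i = l then g w • v l else 0 := by
    intro i
    by_cases h : i = l
    · subst h; simp [add_smul]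
    · simp [h]
  have h3 := hv (Function.update g l (g l + g w)) (by
    rw [← hg, Finset.sum_congr rfl fun i _ => h1 i, Finset.sum_congr rfl fun i _ => h2 i]
    simp [Finset.sum_add_distrib])
  have hgw : g w = 0 := by simpa [hwl] using h3 w
  intro i
  by_cases h : i = l
  · subst h
    simpa [hgw] using h3 i
  · simpa [h] using h3 i

theorem LinearIndependent.sum_finset_ne_zero {v : A → ℝ} (hv : LinearIndependent ℚ v)
    {S : Finset A} (hS : S.Nonempty) : ∑ a ∈ S, v a ≠ 0 := by
  classical
  intro h
  obtain ⟨c, hc⟩ := hS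
  have := Fintype.linearIndependent_iff.1 hv (fun i => if i ∈ S then 1 else 0) (by simpa using h) c
  simp [hc] at this

/-- Take the first block of consecutive letters satisfying `P`. Its sum is the difference of the
partial sums at its two ends. Each end is adjacent to a letter outside `P` or is the start of the
row, so both partial sums lie in `[0, ε)`. The block does end, since the last letter of the row is
outside `P`. -/
theorem exists_block_of_small_sums {r : A ≃ Fin (Fintype.card A)} {v : A → ℝ} {P : A → Prop}
    {ε : ℝ} {l : A} (hl : (r l : ℕ) + 1 = Fintype.card A) (hPl : ¬ P l) (hP : ∃ c, P c)
    (h : ∀ c, ¬ P c → 0 ≤ rowSum r v c ∧ rowSum r v c < ε ∧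
      0 ≤ rowSum r v c + v c ∧ rowSum r v c + v c < ε) :
    ∃ S : Finset A, S.Nonempty ∧ (∀ c ∈ S, P c) ∧ |∑ c ∈ S, v c| < ε := by
  classical
  obtain ⟨b, hb, hbmin⟩ := Finset.exists_min_image (Finset.univ.filter P) r
    (by obtain ⟨c, hc⟩ := hP; exact ⟨c, by simpa using hc⟩)
  simp only [Finset.mem_filter, Finset.mem_univ, true_and] at hb hbmin
  have hbl := row_val_ne (r := r) (show b ≠ l by rintro rfl; exact hPl hb)
  have hblt := (r b).isLt
  obtain ⟨e, he, hemin⟩ := Finset.exists_min_image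
    (Finset.univ.filter fun c => ¬ P c ∧ r b < r c) r
    ⟨l, by simp only [Finset.mem_filter, Finset.mem_univ, true_and, Fin.lt_def]
           exact ⟨hPl, by omega⟩⟩
  simp only [Finset.mem_filter, Finset.mem_univ, true_and] at he hemin
  have hsum : ∑ c with r b ≤ r c ∧ r c < r e, v c = rowSum r v e - rowSum r v b := by
    rw [rowSum, rowSum, eq_sub_iff_add_eq, Finset.sum_filter, Finset.sum_filter,
      Finset.sum_filter, ← Finset.sum_add_distrib]
    apply Finset.sum_congr rfl
    intro c _
    have := he.2
    simp only [Fin.lt_def, Fin.le_def] at this ⊢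
    split_ifs <;> first | (exfalso; omega) | simp
  have hb0 : 0 ≤ rowSum r v b ∧ rowSum r v b < ε := by
    by_cases h0 : (r b : ℕ) = 0
    · rw [rowSum_eq_zero h0]
      have := h e he.1
      exact ⟨le_rfl, by linarith⟩
    · have hc : (r b : ℕ) = r (r.symm ⟨r b - 1, by omega⟩) + 1 := by simp; omega
      rw [rowSum_add_self_of_succ hc]
      refine (h _ fun hPc => ?_).2.2
      have := hbmin _ hPc
      simp only [Fin.le_def] at this
      omega
  refine ⟨Finset.univ.filter fun c => r b ≤ r c ∧ r c < r e, ⟨b, by simpa using he.2⟩,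
    fun c hc => ?_, ?_⟩
  · simp only [Finset.mem_filter, Finset.mem_univ, true_and] at hc
    by_contra hPc
    have hbc : r b ≠ r c := fun hbc => hPc (r.injective hbc ▸ hb)
    exact absurd (hemin c ⟨hPc, lt_of_le_of_ne hc.1 hbc⟩) (not_le.2 hc.2)
  · rw [hsum, abs_lt]
    have := h e he.1
    constructor <;> linarith

/-- The rotation by a half turn, which exchanges the two rows. -/
def halfTurn (x : PermPair A × (A → ℝ)) : PermPair A × (A → ℝ) := (x.1.swap, -x.2)

theorem sum_halfTurn_neg {x : PermPair A × (A → ℝ)} (hx : 0 < ∑ a, x.2 a) :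
    ∑ a, (halfTurn x).2 a < 0 := by
  simpa [halfTurn] using hx

theorem height_halfTurn (x : PermPair A × (A → ℝ)) (c : A) :
    height (halfTurn x).1 (halfTurn x).2 c = height x.1 x.2 c :=
  height_swap_neg _ _ _

variable [Nontrivial A]

/-- The winner of the last Rauzy-Veech step before `x`, which is determined by the sign of the
sum of the suspension data. -/
def backWinner (x : PermPair A × (A → ℝ)) : A :=
  if ∑ a, x.2 a < 0 then x.1.topLast else x.1.botLast

/-- The permutation before the last Rauzy-Veech step. -/
def backPerm (x : PermPair A × (A → ℝ)) : PermPair A :=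
  if ∑ a, x.2 a < 0 then x.1.topUnmove else x.1.swap.topUnmove.swap

/-- The loser of the last Rauzy-Veech step before `x`. -/
def backLoser (x : PermPair A × (A → ℝ)) : A :=
  if ∑ a, x.2 a < 0 then (backPerm x).botLast else (backPerm x).topLast

/-- Backward Rauzy-Veech induction. -/
def back [DecidableEq A] (x : PermPair A × (A → ℝ)) : PermPair A × (A → ℝ) :=
  (backPerm x, Function.update x.2 (backWinner x) (x.2 (backWinner x) + x.2 (backLoser x)))

section HalfTurn

variable {x : PermPair A × (A → ℝ)}

theorem backWinner_halfTurn (hx : 0 < ∑ a, x.2 a) : backWinner (halfTurn x) = backWinner x := by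
  rw [backWinner, backWinner, if_pos (sum_halfTurn_neg hx), if_neg hx.not_gt]
  rfl

theorem backPerm_halfTurn (hx : 0 < ∑ a, x.2 a) :
    backPerm (halfTurn x) = (backPerm x).swap := by
  rw [backPerm, backPerm, if_pos (sum_halfTurn_neg hx), if_neg hx.not_gt]
  rfl

theorem backLoser_halfTurn (hx : 0 < ∑ a, x.2 a) : backLoser (halfTurn x) = backLoser x := by
  rw [backLoser, backLoser, if_pos (sum_halfTurn_neg hx), if_neg hx.not_gt, backPerm_halfTurn hx]
  rfl

theorem back_halfTurn [DecidableEq A] (hx : 0 < ∑ a, x.2 a) :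
    back (halfTurn x) = halfTurn (back x) := by
  rw [back, backPerm_halfTurn hx, backWinner_halfTurn hx, backLoser_halfTurn hx, halfTurn, back]
  refine Prod.ext rfl ?_
  ext c
  by_cases hc : c = backWinner x
  · subst hc; simp [halfTurn, add_comm]
  · simp [halfTurn, hc]

end HalfTurn

section BackTheta

variable [DecidableEq A]

/-- For negative total, `x` is the image of `back x` under a step of top type, so `height_topMove`
can be read backwards. Winner and loser differ because undoing the move fixes the bottom position of
the winner, which is not the last one. -/
theorem back_spec_of_neg {x : PermPair A × (A → ℝ)} (hx : x.2 ∈ Theta x.1)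
    (hs : ∑ a, x.2 a < 0) :
    backWinner x ≠ backLoser x ∧ (back x).2 ∈ Theta (back x).1 ∧
      ∀ c, height (back x).1 (back x).2 c =
        height x.1 x.2 c - if c = backLoser x then height x.1 x.2 (backWinner x) else 0 := by
  have hw : backWinner x = x.1.topUnmove.topLast := by rw [backWinner, if_pos hs]; rfl
  have hperm : backPerm x = x.1.topUnmove := by rw [backPerm, if_pos hs]
  have hl : backLoser x = x.1.topUnmove.botLast := by rw [backLoser, if_pos hs, hperm]
  have hwl : x.1.topUnmove.topLast ≠ x.1.topUnmove.botLast := by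
    intro e
    have h1 := x.1.topUnmove.bot_botLast
    rw [← e, PermPair.topLast_topUnmove, PermPair.bot_topUnmove_topLast] at h1
    have h2 := x.1.bot_botLast
    exact row_val_ne (r := x.1.bot) (topLast_ne_botLast hx) (by omega)
  have hv : reduceVec x.1.topUnmove.topLast x.1.topUnmove.botLast (back x).2 = x.2 := by
    simp only [back, hw, hl]
    ext c
    by_cases hc : c = x.1.topUnmove.topLast
    · subst hc
      simp [reduceVec, Function.update_of_ne hwl.symm]
    · simp [reduceVec, hc]
  have hb1 : (back x).1 = x.1.topUnmove := hperm
  have hh : ∀ c, height x.1 x.2 c = height (back x).1 (back x).2 c +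
      if c = backLoser x then height (back x).1 (back x).2 (backWinner x) else 0 := by
    intro c
    have := height_topMove hwl (back x).2 c
    rw [hv, PermPair.topMove_topUnmove] at this
    rw [this, hb1, hl, hw]
  refine ⟨by rwa [hw, hl], ?_, fun c => ?_⟩
  · rw [hb1]
    refine mem_Theta_of_topMove hwl ?_ ?_
    · rwa [hv, PermPair.topMove_topUnmove]
    · rwa [hv]
  · have h1 := hh c
    have h2 := hh (backWinner x)
    rw [if_neg (by rwa [hw, hl])] at h2
    rw [h1, h2, add_zero, add_sub_cancel_right]

theorem back_spec {x : PermPair A × (A → ℝ)} (hx : x.2 ∈ Theta x.1) (hs : ∑ a, x.2 a ≠ 0) :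
    backWinner x ≠ backLoser x ∧ (back x).2 ∈ Theta (back x).1 ∧
      ∀ c, height (back x).1 (back x).2 c =
        height x.1 x.2 c - if c = backLoser x then height x.1 x.2 (backWinner x) else 0 := by
  rcases hs.lt_or_gt with h | h
  · exact back_spec_of_neg hx h
  · have := back_spec_of_neg (x := halfTurn x) (neg_mem_Theta_swap hx) (sum_halfTurn_neg h)
    simp only [backWinner_halfTurn h, backLoser_halfTurn h, back_halfTurn h,
      height_halfTurn] at this
    refine ⟨this.1, ?_, this.2.2⟩
    have h2 := neg_mem_Theta_swap this.2.1
    simpa [halfTurn, PermPair.swap_swap] using h2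

/-- After a top step the total of the suspension data is the former bottom sum before the loser,
hence negative; so the sign of the total recovers the type of the step. -/
theorem back_topMove {p : PermPair A} {v : A → ℝ} (hv : v ∈ Theta p) :
    ∑ a, reduceVec p.topLast p.botLast v a < 0 ∧
      backWinner (p.topMove, reduceVec p.topLast p.botLast v) = p.topLast ∧
      backLoser (p.topMove, reduceVec p.topLast p.botLast v) = p.botLast ∧
      back (p.topMove, reduceVec p.topLast p.botLast v) = (p, v) := by
  have hs : ∑ a, reduceVec p.topLast p.botLast v a < 0 := by
    rw [sum_reduceVec, ← rowSum_add_self_of_last p.bot_botLast v, add_sub_cancel_right]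
    refine (mem_Theta_iff.1 hv _).2 ?_
    have := p.bot_botLast
    have := Fintype.one_lt_card (α := A)
    omega
  have hne := topLast_ne_botLast hv
  have hw : backWinner (p.topMove, reduceVec p.topLast p.botLast v) = p.topLast := by
    rw [backWinner, if_pos hs]; rfl
  have hp : backPerm (p.topMove, reduceVec p.topLast p.botLast v) = p := by
    rw [backPerm, if_pos hs, PermPair.topUnmove_topMove]
  have hl : backLoser (p.topMove, reduceVec p.topLast p.botLast v) = p.botLast := by
    rw [backLoser, if_pos hs, hp]
  refine ⟨hs, hw, hl, ?_⟩
  rw [back, hw, hl, hp]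
  refine Prod.ext rfl ?_
  ext c
  by_cases hc : c = p.topLast
  · subst hc
    simp [reduceVec, Function.update_of_ne hne.symm]
  · simp [reduceVec, hc]

theorem last_back_of_neg {x : PermPair A × (A → ℝ)} (h : ∑ a, x.2 a < 0) :
    (back x).1.topLast = backWinner x ∧ (back x).1.botLast = backLoser x := by
  rw [back, backWinner, backLoser, if_pos h, if_pos h, backPerm, if_pos h]
  exact ⟨rfl, rfl⟩

theorem last_back_of_not_neg {x : PermPair A × (A → ℝ)} (h : ¬ ∑ a, x.2 a < 0) :
    (back x).1.botLast = backWinner x ∧ (back x).1.topLast = backLoser x := by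
  rw [back, backWinner, backLoser, if_neg h, if_neg h, backPerm, if_neg h]
  exact ⟨rfl, rfl⟩

/-- Before a step, its winner and loser are the two last letters, and the preceding winner is by
definition one of these two. -/
theorem backWinner_back (x : PermPair A × (A → ℝ)) :
    backWinner (back x) = backWinner x ∨ backWinner (back x) = backLoser x := by
  rw [backWinner]
  by_cases h : ∑ a, x.2 a < 0
  · rw [(last_back_of_neg h).1, (last_back_of_neg h).2]
    split_ifs <;> simp
  · rw [(last_back_of_not_neg h).1, (last_back_of_not_neg h).2]
    split_ifs <;> simp

end BackTheta

end IETSpacing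

end

/-! ### Infinite backward orbits: every letter wins infinitely often -/

noncomputable section

open Filter Topology

namespace IETSpacing

theorem length_flatMap_le {A B : Type*} {f : A → List B} {L : ℕ} (h : ∀ c, (f c).length ≤ L)
    (W : List A) : (W.flatMap f).length ≤ W.length * L := by
  induction W with
  | nil => simp
  | cons c W ih =>
    simp only [List.flatMap_cons, List.length_append, List.length_cons, add_mul, one_mul]
    have := h c
    omega

variable {A : Type*} [Fintype A] [Nontrivial A]

theorem back_congr {p : PermPair A} {v v' : A → ℝ} (h : ∑ a, v a < 0 ↔ ∑ a, v' a < 0) :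
    backWinner (p, v) = backWinner (p, v') ∧ backLoser (p, v) = backLoser (p, v') ∧
      backPerm (p, v) = backPerm (p, v') := by
  simp only [backLoser, backWinner, backPerm, h, and_self]

variable [DecidableEq A]

/-- An infinite backward Rauzy-Veech orbit of suspension data without vanishing subset sums. -/
structure IsBackOrbit (X : ℕ → PermPair A × (A → ℝ)) : Prop where
  succ : ∀ k, X (k + 1) = back (X k)
  mem : ∀ k, (X k).2 ∈ Theta (X k).1
  sum_ne : ∀ k (S : Finset A), S.Nonempty → ∑ a ∈ S, (X k).2 a ≠ 0

theorem isBackOrbit_iterate {x : PermPair A × (A → ℝ)} (hx : x.2 ∈ Theta x.1)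
    (hind : LinearIndependent ℚ x.2) : IsBackOrbit fun k => back^[k] x := by
  have key : ∀ k, (back^[k] x).2 ∈ Theta (back^[k] x).1 ∧
      LinearIndependent ℚ (back^[k] x).2 := by
    intro k
    induction k with
    | zero => exact ⟨hx, hind⟩
    | succ k ih =>
      rw [Function.iterate_succ_apply']
      have hs := back_spec ih.1 (LinearIndependent.sum_finset_ne_zero ih.2 Finset.univ_nonempty)
      exact ⟨hs.2.1, linearIndependent_update_add ih.2 hs.1⟩
  exact ⟨fun k => Function.iterate_succ_apply' _ _ _, fun k => (key k).1,
    fun k S hS => LinearIndependent.sum_finset_ne_zero (key k).2 hS⟩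

namespace IsBackOrbit

variable {X : ℕ → PermPair A × (A → ℝ)} (hX : IsBackOrbit X)
include hX

theorem sum_univ_ne (k : ℕ) : ∑ a, (X k).2 a ≠ 0 :=
  hX.sum_ne k _ Finset.univ_nonempty

theorem height_pos (k : ℕ) (c : A) : 0 < height (X k).1 (X k).2 c :=
  IETSpacing.height_pos (hX.mem k) c

theorem height_succ (k : ℕ) (c : A) : height (X (k + 1)).1 (X (k + 1)).2 c =
    height (X k).1 (X k).2 c -
      if c = backLoser (X k) then height (X k).1 (X k).2 (backWinner (X k)) else 0 := by
  rw [hX.succ]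
  exact (back_spec (hX.mem k) (hX.sum_univ_ne k)).2.2 c

theorem backWinner_ne_backLoser (k : ℕ) : backWinner (X k) ≠ backLoser (X k) :=
  (back_spec (hX.mem k) (hX.sum_univ_ne k)).1

theorem height_antitone (c : A) : Antitone fun k => height (X k).1 (X k).2 c := by
  refine antitone_nat_of_succ_le fun k => ?_
  rw [hX.height_succ]
  have := hX.height_pos k (backWinner (X k))
  split_ifs <;> linarith

/-- The height of the winner is the decrement of the total height, which is nonincreasing and
nonnegative, hence convergent. -/
theorem tendsto_height_backWinner :
    Tendsto (fun k => height (X k).1 (X k).2 (backWinner (X k))) atTop (𝓝 0) := by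
  have hsucc : ∀ k, ∑ c, height (X (k + 1)).1 (X (k + 1)).2 c =
      ∑ c, height (X k).1 (X k).2 c - height (X k).1 (X k).2 (backWinner (X k)) := by
    intro k
    rw [Finset.sum_congr rfl fun c _ => hX.height_succ k c]
    simp
  have hanti : Antitone fun k => ∑ c, height (X k).1 (X k).2 c := fun i j hij =>
    Finset.sum_le_sum fun c _ => hX.height_antitone c hij
  obtain ⟨L, hL⟩ : ∃ L, Tendsto (fun k => ∑ c, height (X k).1 (X k).2 c) atTop (𝓝 L) := by
    refine ⟨_, tendsto_atTop_ciInf hanti ⟨0, ?_⟩⟩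
    rintro _ ⟨k, rfl⟩
    exact Finset.sum_nonneg fun c _ => (hX.height_pos k c).le
  have := hL.sub (hL.comp (tendsto_add_atTop_nat 1))
  rw [sub_self] at this
  refine this.congr fun k => ?_
  simp only [Function.comp]
  rw [hsucc]
  ring

/-- A permanent winner is never the loser, so it would keep its positive height, while the heights
of winners tend to `0`. -/
theorem not_eventually_backWinner_const :
    ¬ ∀ᶠ k in atTop, backWinner (X (k + 1)) = backWinner (X k) := by
  intro h
  obtain ⟨K, hK⟩ := eventually_atTop.1 h
  have hw : ∀ k ≥ K, backWinner (X k) = backWinner (X K) ∧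
      height (X k).1 (X k).2 (backWinner (X K)) = height (X K).1 (X K).2 (backWinner (X K)) := by
    intro k hk
    induction k, hk using Nat.le_induction with
    | base => exact ⟨rfl, rfl⟩
    | succ k hk ih =>
      refine ⟨(hK k hk).trans ih.1, ?_⟩
      have := hX.backWinner_ne_backLoser k
      rw [ih.1] at this
      rw [hX.height_succ, ih.2, if_neg this, sub_zero]
  have h1 := tendsto_order.1 hX.tendsto_height_backWinner
  obtain ⟨k, hk1, hk2⟩ := ((h1.2 _ (hX.height_pos K (backWinner (X K)))).and
    (eventually_ge_atTop K)).exists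
  rw [(hw k hk2).1, (hw k hk2).2] at hk1
  exact lt_irrefl _ hk1

/-- Otherwise the sign of the total is eventually constant. Then the winner is always the last
letter of one fixed row, and such steps do not change that letter. -/
theorem frequently_neg_pos :
    ∃ᶠ k in atTop, ∑ a, (X k).2 a < 0 ∧ 0 < ∑ a, (X (k + 1)).2 a := by
  intro h
  obtain ⟨K, hK⟩ := eventually_atTop.1 h
  have hneg : ∀ k ≥ K, ∑ a, (X k).2 a < 0 → ∑ a, (X (k + 1)).2 a < 0 := by
    intro k hk h1
    by_contra h2
    exact hK k hk ⟨h1, lt_of_le_of_ne (not_lt.1 h2) (hX.sum_univ_ne _).symm⟩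
  apply hX.not_eventually_backWinner_const
  by_cases hex : ∃ k ≥ K, ∑ a, (X k).2 a < 0
  · obtain ⟨k0, hk0, h0⟩ := hex
    have hall : ∀ k ≥ k0, ∑ a, (X k).2 a < 0 := fun k hk =>
      Nat.le_induction h0 (fun k hk ih => hneg k (hk0.trans hk) ih) k hk
    filter_upwards [eventually_ge_atTop k0] with k hk
    rw [backWinner, if_pos (hall _ (by omega)), hX.succ, (last_back_of_neg (hall k hk)).1]
  · push Not at hex
    filter_upwards [eventually_ge_atTop K] with k hk
    rw [backWinner, if_neg (hex _ (by omega)).not_gt, hX.succ,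
      (last_back_of_not_neg (hex k hk).not_gt).1]

theorem eventually_height_lt {c : A} (hc : ∃ᶠ k in atTop, backWinner (X k) = c) {η : ℝ}
    (hη : 0 < η) : ∀ᶠ k in atTop, height (X k).1 (X k).2 c < η := by
  have h1 := (tendsto_order.1 hX.tendsto_height_backWinner).2 _ hη
  obtain ⟨k0, hk0, h0⟩ := (hc.and_eventually h1).exists
  rw [hk0] at h0
  filter_upwards [eventually_ge_atTop k0] with k hk
  exact (hX.height_antitone c hk).trans_lt h0

/-- Every letter wins infinitely often. -/
theorem frequently_backWinner_eq (c : A) : ∃ᶠ k in atTop, backWinner (X k) = c := by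
  by_contra hc
  have hw : ∀ᶠ k in atTop, ∀ b, ¬ (∃ᶠ k in atTop, backWinner (X k) = b) → backWinner (X k) ≠ b := by
    rw [eventually_all]
    intro b
    by_cases hb : ∃ᶠ k in atTop, backWinner (X k) = b
    · exact Eventually.of_forall fun k h => absurd hb h
    · exact (not_frequently.1 hb).mono fun k h _ => h
  obtain ⟨K, hK⟩ := eventually_atTop.1 hw
  -- A backward step alters only the coordinate of its winner, so letters that have stopped winning
  -- are frozen.
  have hconst : ∀ b, ¬ (∃ᶠ k in atTop, backWinner (X k) = b) → ∀ k ≥ K,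
      (X k).2 b = (X K).2 b := by
    intro b hb k hk
    induction k, hk using Nat.le_induction with
    | base => rfl
    | succ k hk ih =>
      rw [hX.succ, ← ih]
      exact Function.update_of_ne (hK k hk b hb).symm _ _
  obtain ⟨η, hη, hη0⟩ : ∃ η : ℝ, (∀ S : Finset A, S.Nonempty → η < |∑ a ∈ S, (X K).2 a|) ∧
      0 < η := by
    have : ∀ᶠ η : ℝ in 𝓝[>] 0, ∀ S : Finset A, S.Nonempty → η < |∑ a ∈ S, (X K).2 a| := by
      rw [eventually_all]
      intro S
      by_cases hS : S.Nonempty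
      · filter_upwards [Ioo_mem_nhdsGT (abs_pos.2 (hX.sum_ne K S hS))] with η h _ using h.2
      · exact Eventually.of_forall fun _ h => absurd h hS
    exact (this.and self_mem_nhdsWithin).exists
  have hsmall : ∀ᶠ k in atTop, ∀ b, (∃ᶠ k in atTop, backWinner (X k) = b) →
      height (X k).1 (X k).2 b < η / 2 := by
    rw [eventually_all]
    intro b
    by_cases hb : ∃ᶠ k in atTop, backWinner (X k) = b
    · exact (hX.eventually_height_lt hb (half_pos hη0)).mono fun k h _ => h
    · exact Eventually.of_forall fun _ h => absurd h hb
  -- The change of sign at `k` makes both last letters at time `k + 1` recurrent winners: the top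
  -- one has won at `k`, the bottom one wins at `k + 1`.
  obtain ⟨k, ⟨hneg, hpos⟩, hsm, hkK⟩ := (hX.frequently_neg_pos.and_eventually
    (((tendsto_add_atTop_nat 1).eventually hsmall).and (eventually_ge_atTop K))).exists
  have hwin : ∀ j ≥ K, ∃ᶠ k in atTop, backWinner (X k) = backWinner (X j) := fun j hj => by
    by_contra h
    exact hK j hj _ h rfl
  have htop : (X (k + 1)).1.topLast = backWinner (X k) := by
    rw [hX.succ, (last_back_of_neg hneg).1]
  have hbot : (X (k + 1)).1.botLast = backWinner (X (k + 1)) := by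
    rw [backWinner, if_neg hpos.not_gt]
  have hne := topLast_ne_botLast (hX.mem (k + 1))
  have hT := hsm _ (hwin k hkK)
  rw [← htop] at hT
  -- The total is the height of the last top letter plus its inclusive bottom sum, and the latter is
  -- negative.
  have hsumlt : ∑ a, (X (k + 1)).2 a < η / 2 := by
    have h1 := rowSum_add_self_of_last (X (k + 1)).1.top_topLast (X (k + 1)).2
    have h2 := rowSum_add_self_neg (hX.mem (k + 1)) hne
    unfold height at hT
    linarith
  -- For a recurrent letter the inclusive top sum is its height plus its inclusive bottom sum. The
  -- latter is negative, except at the last bottom letter, where it is the total; hence the two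
  -- halves of `η`.
  obtain ⟨S, hS, hSP, hSsum⟩ := exists_block_of_small_sums
    (P := fun b => ¬ (∃ᶠ k in atTop, backWinner (X k) = b)) (v := (X (k + 1)).2) (ε := η)
    (X (k + 1)).1.top_topLast (by rw [htop, not_not]; exact hwin k hkK) ⟨c, hc⟩ (by
      intro b hb
      rw [not_not] at hb
      have hb1 := hsm b hb
      have h0 := rowSum_nonneg_of_mem_Theta (hX.mem (k + 1)) b
      refine ⟨h0.1, ?_, ?_, ?_⟩
      · unfold height at hb1
        linarith
      · by_cases hbt : b = (X (k + 1)).1.topLast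
        · rw [hbt, rowSum_add_self_of_last (X (k + 1)).1.top_topLast]
          exact hpos.le
        · exact (rowSum_add_self_pos (hX.mem (k + 1)) hbt).le
      · unfold height at hb1
        by_cases hbb : b = (X (k + 1)).1.botLast
        · have h1 := rowSum_add_self_of_last (X (k + 1)).1.bot_botLast (X (k + 1)).2
          rw [← hbb] at h1
          linarith
        · have := rowSum_add_self_neg (hX.mem (k + 1)) hbb
          linarith)
  have := hη S hS
  rw [Finset.sum_congr rfl fun b hb => (hconst b (hSP b hb) (k + 1) (by omega)).symm] at this
  linarith

end IsBackOrbit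

/-! ### Substitutions of finitely many backward steps: positivity and local constancy -/

/-- The word into which a level of the loser-winner step before `x` is subdivided. -/
def stepWord (x : PermPair A × (A → ℝ)) (c : A) : List A :=
  if c = backWinner x then [c, backLoser x] else [c]

/-- The substitution of the last `k` steps of Rauzy-Veech induction before `x`. -/
def backWord (x : PermPair A × (A → ℝ)) : ℕ → A → List A
  | 0 => fun c => [c]
  | k + 1 => fun c => (stepWord (back^[k] x) c).flatMap (backWord x k)

theorem stepWord_length_le (x : PermPair A × (A → ℝ)) (c : A) : (stepWord x c).length ≤ 2 := by
  unfold stepWord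
  split_ifs <;> simp

theorem backWord_length_le (x : PermPair A × (A → ℝ)) (k : ℕ) (c : A) :
    (backWord x k c).length ≤ 2 ^ k := by
  induction k generalizing c with
  | zero => simp [backWord]
  | succ k ih =>
    rw [pow_succ']
    exact (length_flatMap_le ih _).trans (Nat.mul_le_mul_right _ (stepWord_length_le _ _))

theorem self_mem_backWord (x : PermPair A × (A → ℝ)) (k : ℕ) (c : A) : c ∈ backWord x k c := by
  induction k with
  | zero => simp [backWord]
  | succ k ih =>
    rw [backWord, List.mem_flatMap]
    refine ⟨c, ?_, ih⟩
    unfold stepWord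
    split_ifs <;> simp

theorem backWord_subset_succ (x : PermPair A × (A → ℝ)) (k : ℕ) (c : A) :
    backWord x k c ⊆ backWord x (k + 1) c := by
  intro a ha
  rw [backWord, List.mem_flatMap]
  refine ⟨c, ?_, ha⟩
  unfold stepWord
  split_ifs <;> simp

/-- At step `k` the word of the winner absorbs those of winner and loser, and the next winner is one
of these two. -/
theorem backWord_winner_subset (x : PermPair A × (A → ℝ)) (k : ℕ) :
    backWord x k (backWinner (back^[k + 1] x)) ⊆ backWord x (k + 1) (backWinner (back^[k] x)) := by
  intro a ha
  rw [backWord, List.mem_flatMap]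
  refine ⟨_, ?_, ha⟩
  rw [stepWord, if_pos rfl, Function.iterate_succ_apply']
  rcases backWinner_back (back^[k] x) with h | h <;> rw [h] <;> simp

/-- For rationally independent suspension data, some substitution is positive. -/
theorem exists_backWord_full {x : PermPair A × (A → ℝ)} (hx : x.2 ∈ Theta x.1)
    (hind : LinearIndependent ℚ x.2) : ∃ m, ∀ a c, a ∈ backWord x m c := by
  have hX := isBackOrbit_iterate hx hind
  -- The set of letters occurring in each word grows with `k` inside a finite order, so it is
  -- constant from some `m` on.
  let S : ℕ →o (A → Finset A) := ⟨fun k c => (backWord x k c).toFinset,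
    monotone_nat_of_le_succ fun k c a => by
      simp only [List.mem_toFinset]
      exact fun h => backWord_subset_succ x k c h⟩
  obtain ⟨m, hm⟩ := WellFoundedGT.monotone_chain_condition S
  have hS : ∀ k ≥ m, ∀ a c, a ∈ backWord x k c ↔ a ∈ backWord x m c := by
    intro k hk a c
    have := congrFun (hm k hk) c
    rw [← List.mem_toFinset, ← List.mem_toFinset]
    exact (Finset.ext_iff.1 this a).symm
  -- After stabilization the inclusions of `backWord_winner_subset` chain up along the orbit. It
  -- remains to let `c` win first and `a` later.
  have hdec : ∀ i ≥ m, ∀ j ≥ i, backWord x m (backWinner (back^[j] x)) ⊆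
      backWord x m (backWinner (back^[i] x)) := by
    intro i hi j hj
    induction j, hj using Nat.le_induction with
    | base => exact List.Subset.refl _
    | succ j hj ih =>
      refine List.Subset.trans (fun a ha => ?_) ih
      have h1 := backWord_winner_subset x j ((hS j (by omega) a _).2 ha)
      exact (hS (j + 1) (by omega) a _).1 h1
  refine ⟨m, fun a c => ?_⟩
  obtain ⟨i, hi, him⟩ := ((hX.frequently_backWinner_eq c).and_eventually
    (eventually_ge_atTop m)).exists
  obtain ⟨j, hj, hji⟩ := ((hX.frequently_backWinner_eq a).and_eventually
    (eventually_ge_atTop i)).exists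
  have := hdec i him j hji
  rw [hi, hj] at this
  exact this (self_mem_backWord x m a)

/-- The combinatorics of finitely many backward steps is locally constant. -/
theorem eventually_backWord_eq {p : PermPair A} {v : A → ℝ} (hv : v ∈ Theta p)
    (hind : LinearIndependent ℚ v) (m : ℕ) :
    ∀ᶠ u in 𝓝 v, backWord (p, u) m = backWord (p, v) m := by
  have hX := isBackOrbit_iterate (x := (p, v)) hv hind
  -- The induction also carries continuity of the data and constancy of the permutation: together
  -- with the nonvanishing total they fix the type of the next step.
  suffices H : ∀ m, ContinuousAt (fun u => (back^[m] (p, u)).2) v ∧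
      (∀ᶠ u in 𝓝 v, (back^[m] (p, u)).1 = (back^[m] (p, v)).1) ∧
      ∀ᶠ u in 𝓝 v, backWord (p, u) m = backWord (p, v) m from (H m).2.2
  intro m
  induction m with
  | zero => exact ⟨continuousAt_id, Eventually.of_forall fun _ => rfl,
      Eventually.of_forall fun _ => rfl⟩
  | succ m ih =>
    obtain ⟨hc, hp, hw⟩ := ih
    have hsum : ContinuousAt (fun u => ∑ a, (back^[m] (p, u)).2 a) v :=
      tendsto_finsetSum _ fun a _ => (continuous_apply a).continuousAt.comp hc
    have hsign : ∀ᶠ u in 𝓝 v, (∑ a, (back^[m] (p, u)).2 a < 0 ↔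
        ∑ a, (back^[m] (p, v)).2 a < 0) := by
      rcases (hX.sum_univ_ne m).lt_or_gt with h | h
      · filter_upwards [hsum.eventually_lt_const h] with u hu using iff_of_true hu h
      · filter_upwards [hsum.eventually_const_lt h] with u hu
          using iff_of_false hu.not_gt h.not_gt
    have hdata : ∀ᶠ u in 𝓝 v,
        backWinner (back^[m] (p, u)) = backWinner (back^[m] (p, v)) ∧
        backLoser (back^[m] (p, u)) = backLoser (back^[m] (p, v)) ∧
        backPerm (back^[m] (p, u)) = backPerm (back^[m] (p, v)) := by
      filter_upwards [hsign, hp] with u h1 h2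
      have := back_congr (p := (back^[m] (p, v)).1) h1
      nth_rewrite 1 [← h2] at this
      nth_rewrite 2 [← h2] at this
      nth_rewrite 3 [← h2] at this
      exact this
    simp only [Function.iterate_succ_apply']
    refine ⟨?_, hdata.mono fun u h => h.2.2, ?_⟩
    · have hc' : ContinuousAt (fun u => Function.update (back^[m] (p, u)).2
          (backWinner (back^[m] (p, v))) ((back^[m] (p, u)).2 (backWinner (back^[m] (p, v))) +
            (back^[m] (p, u)).2 (backLoser (back^[m] (p, v))))) v :=
        hc.update _ (((continuous_apply _).continuousAt.comp hc).add
          ((continuous_apply _).continuousAt.comp hc))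
      refine hc'.congr (hdata.mono fun u h => ?_)
      simp only [back, h.1, h.2.1]
    · filter_upwards [hdata, hw] with u h1 h2
      simp only [backWord, h2, stepWord, h1.1, h1.2.1]

end IETSpacing

end

/-! ### Rauzy–Veech towers and the order of their levels -/

noncomputable section

namespace IETSpacing

theorem reduceVec_of_ne {A : Type*} [DecidableEq A] {w l c : A} (h : c ≠ w) (v : A → ℝ) :
    reduceVec w l v c = v c :=
  Function.update_of_ne h _ _

theorem reduceVec_self {A : Type*} [DecidableEq A] (w l : A) (v : A → ℝ) :
    reduceVec w l v w = v w - v l :=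
  Function.update_self _ _ _

theorem reduceVec_pos {A : Type*} [DecidableEq A] {w l : A} {v : A → ℝ} (hv : ∀ c, 0 < v c)
    (h : v l < v w) (c : A) :
    0 < reduceVec w l v c := by
  by_cases hc : c = w
  · rw [hc, reduceVec_self]
    linarith
  · rw [reduceVec_of_ne hc]
    exact hv c

/-- `W` lists, from `x` to `Λ`, adjacent intervals of lengths given by `v`, and `D c z` holds for
each interval of type `c` with left endpoint `z`. -/
def Tiles {A : Type*} (D : A → ℝ → Prop) (v : A → ℝ) (Λ : ℝ) : ℝ → List A → Prop
  | x, [] => x = Λ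
  | x, c :: W => D c x ∧ Tiles D v Λ (x + v c) W

/-- Each winner interval is cut into a shorter winner interval followed by a loser interval of
length `v l`; all other intervals are kept. -/
theorem Tiles.flatMap {A : Type*} [DecidableEq A] {D D' : A → ℝ → Prop} {v v' : A → ℝ} {Λ : ℝ}
    {w l : A}
    (hv : v' = reduceVec w l v) (hwl : w ≠ l) (h1 : ∀ c x, D c x → D' c x)
    (h2 : ∀ x, D w x → D' l (x + v w - v l)) {W : List A} {x : ℝ} (h : Tiles D v Λ x W) :
    Tiles D' v' Λ x (W.flatMap fun c => if c = w then [c, l] else [c]) := by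
  induction W generalizing x with
  | nil => exact h
  | cons c W ih =>
    obtain ⟨hc, hW⟩ := h
    have := ih hW
    rw [List.flatMap_cons]
    by_cases hcw : c = w
    · subst hcw
      rw [if_pos rfl]
      refine ⟨h1 _ _ hc, ?_, ?_⟩
      · rw [hv, reduceVec_self, ← add_sub_assoc]
        exact h2 x hc
      · have e : x + v' c + v' l = x + v c := by
          rw [hv, reduceVec_self, reduceVec_of_ne hwl.symm]
          ring
        rwa [e]
    · rw [if_neg hcw]
      refine ⟨h1 _ _ hc, ?_⟩
      rwa [hv, reduceVec_of_ne hcw, ← hv]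

variable {A : Type*} [Fintype A]

theorem height_swap (p : PermPair A) (v : A → ℝ) (c : A) :
    height p.swap v c = -height p v c := by
  simp only [height, PermPair.swap]
  ring

theorem rowSum_nonneg {r : A ≃ Fin (Fintype.card A)} {v : A → ℝ} (hv : ∀ c, 0 < v c) (c : A) :
    0 ≤ rowSum r v c :=
  Finset.sum_nonneg fun c _ => (hv c).le

/-- The intervals of a row follow one another in the order of the row. -/
theorem rowSum_add_self_le {r : A ≃ Fin (Fintype.card A)} {v : A → ℝ} (hv : ∀ c, 0 < v c)
    {c e : A} (h : r c < r e) : rowSum r v c + v c ≤ rowSum r v e := by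
  classical
  rw [rowSum, rowSum, add_comm, ← Finset.sum_insert (by simp)]
  refine Finset.sum_le_sum_of_subset_of_nonneg (fun b hb => ?_) fun b _ _ => (hv b).le
  simp only [Finset.mem_filter, Finset.mem_univ, true_and, Finset.mem_insert] at hb ⊢
  rcases hb with rfl | hb
  · exact h
  · exact hb.trans h

theorem rowSum_add_self_le_sum {r : A ≃ Fin (Fintype.card A)} {v : A → ℝ} (hv : ∀ c, 0 < v c)
    (c : A) : rowSum r v c + v c ≤ ∑ a, v a := by
  classical
  rw [rowSum, add_comm, ← Finset.sum_insert (by simp)]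
  exact Finset.sum_le_sum_of_subset_of_nonneg (Finset.subset_univ _) fun b _ _ => (hv b).le

theorem exchInterval_eq (p : PermPair A) (v : A → ℝ) (c : A) :
    exchInterval p v c = Set.Ico (rowSum p.top v c) (rowSum p.top v c + v c) := by
  classical
  have : Finset.univ.filter (fun b => p.top b ≤ p.top c)
      = insert c (Finset.univ.filter fun b => p.top b < p.top c) := by
    ext b
    simp only [Finset.mem_filter, Finset.mem_univ, true_and, Finset.mem_insert]
    rw [le_iff_eq_or_lt, p.top.injective.eq_iff]
  rw [exchInterval, this, Finset.sum_insert (by simp), add_comm (v c)]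
  rfl

theorem mem_exchInterval {p : PermPair A} {v : A → ℝ} {c : A} {y : ℝ} :
    y ∈ exchInterval p v c ↔ rowSum p.top v c ≤ y ∧ y < rowSum p.top v c + v c := by
  rw [exchInterval_eq, Set.mem_Ico]

/-- The expression `height` has two uses: on suspension data it is the height of a rectangle, on
lengths it is minus the translation of the exchanged interval. -/
theorem omegaMatrix_mulVec (p : PermPair A) (v : A → ℝ) (c : A) :
    (omegaMatrix p).mulVec v c = -height p v c := by
  rw [height, rowSum, rowSum, neg_sub, Finset.sum_filter, Finset.sum_filter,
    ← Finset.sum_sub_distrib]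
  refine Finset.sum_congr rfl fun b _ => ?_
  simp only [omegaMatrix, Matrix.of_apply]
  by_cases hbc : b = c
  · subst hbc; simp
  · have h1 := row_val_ne (r := p.top) hbc
    have h2 := row_val_ne (r := p.bot) hbc
    simp only [Fin.lt_def]
    split_ifs <;> first | (exfalso; omega) | simp

theorem iet_eq {p : PermPair A} {v : A → ℝ} (hv : ∀ c, 0 < v c) {c : A} {y : ℝ}
    (hy : y ∈ exchInterval p v c) : iet p v y = y - height p v c := by
  classical
  rw [iet, Finset.sum_eq_single c, if_pos hy, omegaMatrix_mulVec, sub_eq_add_neg]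
  · intro b _ hbc
    refine if_neg fun hb => ?_
    rw [mem_exchInterval] at hy hb
    rcases lt_or_gt_of_ne (fun h => hbc (p.top.injective h)) with h | h
    · linarith [rowSum_add_self_le hv h]
    · linarith [rowSum_add_self_le hv h]
  · simp

theorem iet_mem_baseInterval {p : PermPair A} {v : A → ℝ} (hv : ∀ c, 0 < v c) {c : A} {y : ℝ}
    (hy : y ∈ exchInterval p v c) : iet p v y ∈ baseInterval v := by
  rw [iet_eq hv hy, height]
  rw [mem_exchInterval] at hy
  have h1 := rowSum_nonneg (r := p.bot) hv c
  have h2 := rowSum_add_self_le_sum (r := p.bot) hv c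
  constructor <;> linarith [hy.1, hy.2]

/-- How the exchanged intervals and the transformation change under one step of Rauzy-Veech
induction with winner `w` and loser `l`. -/
structure IsStep [DecidableEq A] (p : PermPair A) (v : A → ℝ) (p' : PermPair A) (v' : A → ℝ)
    (w l : A) : Prop where
  ne : w ≠ l
  lt : v l < v w
  eq : v' = reduceVec w l v
  left : ∀ c, c ≠ l → rowSum p'.top v' c = rowSum p.top v c
  iet_eq : ∀ c, c ≠ l → ∀ y ∈ exchInterval p' v' c, iet p' v' y = iet p v y
  loser : (rowSum p'.top v' l = rowSum p.top v l ∧ ∀ y ∈ exchInterval p' v' l,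
      iet p v y ∈ exchInterval p v w ∧
      iet p v y = y - rowSum p.top v l + (rowSum p.top v w + v w - v l) ∧
      iet p v y ∉ baseInterval v' ∧ iet p' v' y = iet p v (iet p v y)) ∨
    (rowSum p'.top v' l = rowSum p.top v w + v w - v l ∧ ∀ y ∈ exchInterval p' v' l,
      iet p v y ∈ exchInterval p v l ∧
      iet p v y = y - (rowSum p.top v w + v w - v l) + rowSum p.top v l ∧
      iet p v y ∉ baseInterval v' ∧ iet p' v' y = iet p v (iet p v y))

section Step

variable [DecidableEq A]

variable [Nontrivial A]

/-- In the top type `T` maps the loser's interval to the right end of `I`, which lies in the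
winner's interval and is cut off; one more iterate of `T` completes the return. -/
theorem isStep_top {p : PermPair A} {v : A → ℝ} (hv : ∀ c, 0 < v c)
    (h : v p.botLast < v p.topLast) :
    IsStep p v p.topMove (reduceVec p.topLast p.botLast v) p.topLast p.botLast := by
  have hne : p.topLast ≠ p.botLast := fun e => by rw [e] at h; exact lt_irrefl _ h
  have hv' := reduceVec_pos hv h
  have hleft : ∀ c, rowSum p.topMove.top (reduceVec p.topLast p.botLast v) c = rowSum p.top v c :=
    rowSum_reduceVec_last p.top_topLast v
  have hle : ∀ c, reduceVec p.topLast p.botLast v c ≤ v c := by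
    intro c
    by_cases hc : c = p.topLast
    · rw [hc, reduceVec_self]
      linarith [hv p.botLast]
    · rw [reduceVec_of_ne hc]
  have hmem : ∀ c, ∀ y ∈ exchInterval p.topMove (reduceVec p.topLast p.botLast v) c,
      y ∈ exchInterval p v c := by
    intro c y hy
    rw [mem_exchInterval, hleft] at hy
    rw [mem_exchInterval]
    exact ⟨hy.1, hy.2.trans_le (by linarith [hle c])⟩
  have h1 := rowSum_add_self_of_last p.top_topLast v
  have h2 := rowSum_add_self_of_last p.bot_botLast v
  refine ⟨hne, h, rfl, fun c _ => hleft c, fun c hc y hy => ?_, Or.inl ⟨hleft _, fun y hy => ?_⟩⟩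
  · rw [iet_eq hv' hy, iet_eq hv (hmem c y hy), height_topMove hne, if_neg hc, add_zero]
  · have hy1 := hmem _ y hy
    have hT : iet p v y =
        y - rowSum p.top v p.botLast + (rowSum p.top v p.topLast + v p.topLast - v p.botLast) := by
      rw [iet_eq hv hy1, height]
      linarith
    have hy2 := mem_exchInterval.1 hy1
    have hTw : iet p v y ∈ exchInterval p v p.topLast := by
      rw [mem_exchInterval, hT]
      constructor <;> linarith [hy2.1, hy2.2]
    refine ⟨hTw, hT, fun hb => ?_, ?_⟩
    · have := hb.2
      rw [sum_reduceVec, hT] at this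
      linarith [hy2.1]
    · rw [iet_eq hv' hy, iet_eq hv hTw, iet_eq hv hy1, height_topMove hne, if_pos rfl]
      ring

/-- In the bottom type the new loser interval is the right end of the winner's interval. It is
mapped onto the old loser interval, the cut-off right end of `I`, before returning. -/
theorem isStep_bot {p : PermPair A} {v : A → ℝ} (hv : ∀ c, 0 < v c)
    (h : v p.topLast < v p.botLast) :
    IsStep p v p.swap.topMove.swap (reduceVec p.botLast p.topLast v) p.botLast p.topLast := by
  have hne : p.botLast ≠ p.topLast := fun e => by rw [e] at h; exact lt_irrefl _ h
  have hv' := reduceVec_pos hv h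
  have hleft : ∀ c, c ≠ p.topLast → rowSum p.swap.topMove.swap.top
      (reduceVec p.botLast p.topLast v) c = rowSum p.top v c := fun c hc =>
    rowSum_move_of_ne p.top_topLast hne v hc
  have hleft' : rowSum p.swap.topMove.swap.top (reduceVec p.botLast p.topLast v) p.topLast =
      rowSum p.top v p.botLast + v p.botLast - v p.topLast :=
    rowSum_move_self p.top_topLast hne v
  have hheight : ∀ c, height p.swap.topMove.swap (reduceVec p.botLast p.topLast v) c =
      height p v c + if c = p.topLast then height p v p.botLast else 0 := by
    intro c
    have e : height p.swap.topMove (reduceVec p.botLast p.topLast v) c = height p.swap v c +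
        if c = p.topLast then height p.swap v p.botLast else 0 :=
      height_topMove (p := p.swap) hne v c
    rw [height_swap, e, height_swap, height_swap]
    split_ifs <;> ring
  have hle : ∀ c, reduceVec p.botLast p.topLast v c ≤ v c := by
    intro c
    by_cases hc : c = p.botLast
    · rw [hc, reduceVec_self]
      linarith [hv p.topLast]
    · rw [reduceVec_of_ne hc]
  have h1 := rowSum_add_self_of_last p.top_topLast v
  have h2 := rowSum_add_self_of_last p.bot_botLast v
  refine ⟨hne, h, rfl, hleft, fun c hc y hy => ?_, Or.inr ⟨hleft', fun y hy => ?_⟩⟩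
  · have hy1 : y ∈ exchInterval p v c := by
      rw [mem_exchInterval, hleft c hc] at hy
      rw [mem_exchInterval]
      exact ⟨hy.1, hy.2.trans_le (by linarith [hle c])⟩
    rw [iet_eq hv' hy, iet_eq hv hy1, hheight, if_neg hc, add_zero]
  · have hy2 := mem_exchInterval.1 hy
    rw [hleft', reduceVec_of_ne hne.symm] at hy2
    have hy1 : y ∈ exchInterval p v p.botLast := by
      rw [mem_exchInterval]
      constructor <;> linarith [hy2.1, hy2.2]
    have hT : iet p v y =
        y - (rowSum p.top v p.botLast + v p.botLast - v p.topLast) + rowSum p.top v p.topLast := by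
      rw [iet_eq hv hy1, height]
      linarith
    have hTl : iet p v y ∈ exchInterval p v p.topLast := by
      rw [mem_exchInterval, hT]
      constructor <;> linarith [hy2.1, hy2.2]
    refine ⟨hTl, hT, fun hb => ?_, ?_⟩
    · have := hb.2
      rw [sum_reduceVec, hT] at this
      linarith [hy2.1]
    · rw [iet_eq hv' hy, iet_eq hv hTl, iet_eq hv hy1, hheight, if_pos rfl]
      ring

/-- `rauzyVeech` is a step with the winner and loser found by `back`, which undoes it. -/
theorem rauzyVeech_spec {s : SurfaceData A} (hv : ∀ c, 0 < s.lam c) (hs : s.Inducible)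
    (ht : s.tau ∈ Theta s.perm) :
    IsStep s.perm s.lam (rauzyVeech s).perm (rauzyVeech s).lam
      (backWinner ((rauzyVeech s).perm, (rauzyVeech s).tau))
      (backLoser ((rauzyVeech s).perm, (rauzyVeech s).tau)) ∧
    back ((rauzyVeech s).perm, (rauzyVeech s).tau) = (s.perm, s.tau) ∧
    (rauzyVeech s).tau ∈ Theta (rauzyVeech s).perm := by
  obtain ⟨p, v, τ⟩ := s
  simp only [SurfaceData.Inducible] at *
  rcases hs.lt_or_gt with h | h
  · have e : rauzyVeech ⟨p, v, τ⟩ = ⟨p.swap.topMove.swap, reduceVec p.botLast p.topLast v,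
        reduceVec p.botLast p.topLast τ⟩ := by
      simp only [rauzyVeech, if_neg h.not_gt]
      rfl
    -- The half turn reduces the suspension data of a bottom step to the top case.
    have hneg : -reduceVec p.botLast p.topLast (-τ) = reduceVec p.botLast p.topLast τ := by
      ext c
      by_cases hc : c = p.botLast
      · rw [Pi.neg_apply, hc, reduceVec_self, reduceVec_self]
        simp
        ring
      · rw [Pi.neg_apply, reduceVec_of_ne hc, reduceVec_of_ne hc, Pi.neg_apply, neg_neg]
    have ht' := neg_mem_Theta_swap ht
    obtain ⟨h0, h1, h2, h3⟩ := back_topMove ht'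
    have h4 := neg_mem_Theta_swap (reduceVec_mem_Theta_topMove ht')
    have hx : halfTurn (p.swap.topMove.swap, reduceVec p.botLast p.topLast τ) =
        (p.swap.topMove, reduceVec p.swap.topLast p.swap.botLast (-τ)) := by
      rw [← hneg, halfTurn, neg_neg]
      rfl
    have hpos : 0 < ∑ a, (p.swap.topMove.swap, reduceVec p.botLast p.topLast τ).2 a := by
      have : ∑ a, (halfTurn (p.swap.topMove.swap, reduceVec p.botLast p.topLast τ)).2 a < 0 := by
        rw [hx]; exact h0
      simpa [halfTurn] using this
    rw [← hx] at h1 h2 h3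
    rw [backWinner_halfTurn hpos] at h1
    rw [backLoser_halfTurn hpos] at h2
    rw [back_halfTurn hpos] at h3
    simp only [e]
    rw [h1, h2]
    refine ⟨isStep_bot hv h, ?_, ?_⟩
    · have := congrArg halfTurn h3
      simpa [halfTurn, PermPair.swap_swap] using this
    · rw [← hneg]
      exact h4
  · have e : rauzyVeech ⟨p, v, τ⟩ = ⟨p.topMove, reduceVec p.topLast p.botLast v,
        reduceVec p.topLast p.botLast τ⟩ := by
      simp only [rauzyVeech, if_pos h]
      rfl
    obtain ⟨-, h1, h2, h3⟩ := back_topMove ht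
    simp only [e]
    rw [h1, h2]
    exact ⟨isStep_top hv h, h3, reduceVec_mem_Theta_topMove ht⟩

end Step

/-- The interval of type `c` starting at `x` is a level of the tower of height `q c` over the
exchanged interval `c`. -/
def IsLevel (T : ℝ → ℝ) (p : PermPair A) (v : A → ℝ) (q : A → ℕ) (c : A) (x : ℝ) : Prop :=
  ∃ i < q c, ∀ y ∈ exchInterval p v c, T^[i] y = y - rowSum p.top v c + x

/-- The exchange `(p, v)` is a first return map of `T`, with return times `q`, and the levels of
its towers, in the order of `W`, partition `[0, Λ)`. -/
structure IsTower (T : ℝ → ℝ) (Λ : ℝ) (p : PermPair A) (v : A → ℝ) (q : A → ℕ)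
    (W : List A) : Prop where
  pos : ∀ c, 0 < v c
  q_pos : ∀ c, 0 < q c
  return_eq : ∀ c, ∀ y ∈ exchInterval p v c, T^[q c] y = iet p v y
  not_mem : ∀ c i, 0 < i → i < q c → ∀ y ∈ exchInterval p v c, T^[i] y ∉ baseInterval v
  tiles : Tiles (IsLevel T p v q) v Λ 0 W

theorem isTower_iet {p : PermPair A} {v : A → ℝ} (hv : ∀ c, 0 < v c) :
    IsTower (iet p v) (∑ a, v a) p v (fun _ => 1) (List.ofFn p.top.symm) := by
  refine ⟨hv, fun _ => one_pos, fun c y _ => rfl, fun c i h h' => by omega, ?_⟩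
  have key : ∀ k j, j + k = Fintype.card A →
      Tiles (IsLevel (iet p v) p v fun _ => 1) v (∑ a, v a) (∑ b with (p.top b : ℕ) < j, v b)
        ((List.ofFn p.top.symm).drop j) := by
    intro k
    induction k with
    | zero =>
      intro j hj
      rw [List.drop_of_length_le (by simp; omega), Tiles, Finset.filter_true_of_mem]
      intro b _
      have := (p.top b).isLt
      omega
    | succ k ih =>
      intro j hj
      have hjlt : j < Fintype.card A := by omega
      have hx : ∑ b with (p.top b : ℕ) < j, v b = rowSum p.top v (p.top.symm ⟨j, hjlt⟩) := by
        simp [rowSum, Fin.lt_def]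
      have hnext : ∑ b with (p.top b : ℕ) < j + 1, v b =
          rowSum p.top v (p.top.symm ⟨j, hjlt⟩) + v (p.top.symm ⟨j, hjlt⟩) := by
        classical
        rw [rowSum, add_comm (Finset.sum _ _), ← Finset.sum_insert (by simp)]
        congr 1
        ext b
        simp only [Finset.mem_filter, Finset.mem_univ, true_and, Finset.mem_insert,
          Equiv.apply_symm_apply, Fin.lt_def, Equiv.eq_symm_apply, Fin.ext_iff]
        omega
      rw [List.drop_eq_getElem_cons (by simpa using hjlt), Tiles, List.getElem_ofFn, hx, ← hnext]
      exact ⟨⟨0, one_pos, fun y _ => by simp⟩, ih (j + 1) (by omega)⟩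
  simpa using key (Fintype.card A) 0 (by omega)

theorem IsStep.mem [DecidableEq A] {p p' : PermPair A} {v v' : A → ℝ} {w l : A}
    (hs : IsStep p v p' v' w l) (hv : ∀ c, 0 < v c) {c : A} (hc : c ≠ l) {y : ℝ}
    (hy : y ∈ exchInterval p' v' c) : y ∈ exchInterval p v c := by
  rw [mem_exchInterval, hs.left c hc, hs.eq] at hy
  rw [mem_exchInterval]
  refine ⟨hy.1, hy.2.trans_le ?_⟩
  by_cases hcw : c = w
  · rw [hcw, reduceVec_self]
    linarith [hv l]
  · rw [reduceVec_of_ne hcw]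

/-- Towers after one more step of Rauzy-Veech induction: the tower of the loser is stacked with
the part of the tower of the winner which it cuts off. -/
theorem IsTower.step [DecidableEq A] {T : ℝ → ℝ} {Λ : ℝ} {p p' : PermPair A} {v v' : A → ℝ}
    {q : A → ℕ} {W : List A} {w l : A} (h : IsTower T Λ p v q W) (hs : IsStep p v p' v' w l) :
    IsTower T Λ p' v' (Function.update q l (q l + q w))
      (W.flatMap fun c => if c = w then [c, l] else [c]) := by
  have hv' : ∀ c, 0 < v' c := by
    rw [hs.eq]
    exact reduceVec_pos h.pos hs.lt
  have hvl : v' l = v l := by rw [hs.eq, reduceVec_of_ne hs.ne.symm]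
  have hbase : ∀ y, y ∉ baseInterval v → y ∉ baseInterval v' := by
    intro y hy hy'
    refine hy ⟨hy'.1, hy'.2.trans ?_⟩
    rw [hs.eq, sum_reduceVec]
    linarith [h.pos l]
  have hql : ∀ c, c ≠ l → Function.update q l (q l + q w) c = q c := fun c hc =>
    Function.update_of_ne hc _ _
  -- The new loser orbit climbs first tower `f`, then tower `g`: these are loser and winner in the
  -- top type, winner and loser in the bottom type.
  obtain ⟨f, g, hfg, hf⟩ : ∃ f g, q l + q w = q g + q f ∧ ∀ y ∈ exchInterval p' v' l,
      y ∈ exchInterval p v f ∧ iet p v y ∈ exchInterval p v g ∧ iet p v y ∉ baseInterval v' ∧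
      iet p' v' y = iet p v (iet p v y) := by
    rcases hs.loser with ⟨hl, hs2⟩ | ⟨hl, hs2⟩
    · refine ⟨l, w, add_comm _ _, fun y hy => ⟨?_, (hs2 y hy).1, (hs2 y hy).2.2⟩⟩
      rw [mem_exchInterval, hl, hvl] at hy
      rwa [mem_exchInterval]
    · refine ⟨w, l, rfl, fun y hy => ⟨?_, (hs2 y hy).1, (hs2 y hy).2.2⟩⟩
      rw [mem_exchInterval, hl, hvl] at hy
      rw [mem_exchInterval]
      have := hs.lt
      constructor <;> linarith [hy.1, hy.2]
  refine ⟨hv', fun c => ?_, fun c y hy => ?_, fun c i hi hic y hy => ?_, ?_⟩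
  · by_cases hc : c = l
    · rw [hc, Function.update_self]
      exact Nat.add_pos_left (h.q_pos l) _
    · rw [hql c hc]
      exact h.q_pos c
  · by_cases hc : c = l
    · subst hc
      obtain ⟨hy1, hy2, hy3, hy4⟩ := hf y hy
      rw [Function.update_self, hfg, Function.iterate_add_apply, h.return_eq f y hy1,
        h.return_eq g _ hy2, hy4]
    · rw [hql c hc, h.return_eq c y (hs.mem h.pos hc hy), hs.iet_eq c hc y hy]
  · by_cases hc : c = l
    · subst hc
      obtain ⟨hy1, hy2, hy3, hy4⟩ := hf y hy
      rw [Function.update_self, hfg] at hic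
      rcases lt_trichotomy i (q f) with hlt | heq | hgt
      · exact hbase _ (h.not_mem f i hi hlt y hy1)
      · rw [heq, h.return_eq f y hy1]
        exact hy3
      · obtain ⟨j, rfl⟩ := Nat.exists_eq_add_of_lt hgt
        rw [show q f + j + 1 = (j + 1) + q f by omega, Function.iterate_add_apply,
          h.return_eq f y hy1]
        exact hbase _ (h.not_mem g (j + 1) (by omega) (by omega) _ hy2)
    · rw [hql c hc] at hic
      exact hbase _ (h.not_mem c i hi hic y (hs.mem h.pos hc hy))
  · refine Tiles.flatMap hs.eq hs.ne (fun c x hx => ?_) (fun x hx => ?_) h.tiles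
    · obtain ⟨i, hi, hx⟩ := hx
      by_cases hc : c = l
      · subst hc
        rcases hs.loser with ⟨hl, hs2⟩ | ⟨hl, hs2⟩
        · refine ⟨i, by rw [Function.update_self]; omega, fun y hy => ?_⟩
          rw [hl]
          refine hx y ?_
          rw [mem_exchInterval, hl, hvl] at hy
          rwa [mem_exchInterval]
        -- In the bottom type points pass through the whole winner tower before reaching the old
        -- loser base, so the level index shifts by `q w`.
        · refine ⟨i + q w, by rw [Function.update_self]; omega, fun y hy => ?_⟩
          obtain ⟨h1, h2, -⟩ := hs2 y hy
          have hyw : y ∈ exchInterval p v w := by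
            rw [mem_exchInterval, hl, hvl] at hy
            rw [mem_exchInterval]
            have := hs.lt
            constructor <;> linarith [hy.1, hy.2]
          rw [Function.iterate_add_apply, h.return_eq w y hyw, hx _ h1, h2, hl]
          ring
      · refine ⟨i, by rwa [hql c hc], fun y hy => ?_⟩
        rw [hs.left c hc]
        exact hx y (hs.mem h.pos hc hy)
    · obtain ⟨i, hi, hx⟩ := hx
      rcases hs.loser with ⟨hl, hs2⟩ | ⟨hl, hs2⟩
      · refine ⟨i + q l, by rw [Function.update_self]; omega, fun y hy => ?_⟩
        obtain ⟨h1, h2, -⟩ := hs2 y hy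
        have hyl : y ∈ exchInterval p v l := by
          rw [mem_exchInterval, hl, hvl] at hy
          rwa [mem_exchInterval]
        rw [Function.iterate_add_apply, h.return_eq l y hyl, hx _ h1, h2, hl]
        ring
      · refine ⟨i, by rw [Function.update_self]; omega, fun y hy => ?_⟩
        have hyw : y ∈ exchInterval p v w := by
          rw [mem_exchInterval, hl, hvl] at hy
          rw [mem_exchInterval]
          have := hs.lt
          constructor <;> linarith [hy.1, hy.2]
        rw [hx y hyw, hl]
        ring

end IETSpacing

end

/-! ### Gaps in words and distances between levels -/

noncomputable section

open Topology

namespace IETSpacing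

theorem Tiles.exists_of_mem {A : Type*} {a : A} {D : A → ℝ → Prop} {v : A → ℝ} {Λ : ℝ}
    (hv : ∀ c, 0 < v c) {W : List A} {x : ℝ} (h : Tiles D v Λ x W) (ha : a ∈ W) : ∃ z, x ≤ z ∧ z < Λ ∧ D a z := by
  have hle : ∀ (W : List A) (x : ℝ), Tiles D v Λ x W → x ≤ Λ := by
    intro W
    induction W with
    | nil => exact fun x h => le_of_eq h
    | cons c W ih => exact fun x h => (le_add_of_nonneg_right (hv c).le).trans (ih _ h.2)
  induction W generalizing x with
  | nil => simp at ha
  | cons c W ih =>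
    rcases List.mem_cons.1 ha with rfl | ha
    · exact ⟨x, le_rfl, (lt_add_of_pos_right x (hv a)).trans_le (hle _ _ h.2), h.1⟩
    · obtain ⟨z, hz, hz'⟩ := ih h.2 ha
      exact ⟨z, by linarith [hv c], hz'⟩

/-- The number of letters of `W` before the first occurrence of `a`. -/
def gap {A : Type*} [DecidableEq A] (a : A) (W : List A) : ℕ :=
  (W.takeWhile (· ≠ a)).length

section Words

variable {A : Type*} [DecidableEq A] {a : A}

theorem gap_le_length (W : List A) : gap a W ≤ W.length :=
  (List.takeWhile_prefix _).length_le

theorem gap_cons_of_ne {c : A} (h : c ≠ a) (W : List A) : gap a (c :: W) = gap a W + 1 := by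
  simp [gap, h]

theorem gap_append_le (u r : List A) : gap a (u ++ r) ≤ u.length + gap a r := by
  induction u with
  | nil => simp
  | cons c u ih =>
    by_cases h : c = a
    · simp [gap, h]
    · rw [List.cons_append, gap_cons_of_ne h, List.length_cons]
      omega

theorem gap_append_le_of_mem {u : List A} (h : a ∈ u) (r : List A) :
    gap a (u ++ r) ≤ u.length := by
  induction u with
  | nil => simp at h
  | cons c u ih =>
    by_cases hc : c = a
    · simp [gap, hc]
    · rw [List.cons_append, gap_cons_of_ne hc, List.length_cons]
      have := ih ((List.mem_cons.1 h).resolve_left (Ne.symm hc))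
      omega

/-- Gaps between occurrences of `a` in the image of a substitution all of whose words
contain `a`. -/
theorem gap_drop_flatMap_le {f : A → List A} {L : ℕ} (hf : ∀ c, a ∈ f c)
    (hL : ∀ c, (f c).length ≤ L) (V : List A) (j : ℕ) :
    gap a ((V.flatMap f).drop j) ≤ 2 * L := by
  have h0 : ∀ V : List A, gap a (V.flatMap f) ≤ L := by
    intro V
    cases V with
    | nil => simp [gap]
    | cons c V =>
      rw [List.flatMap_cons]
      exact (gap_append_le_of_mem (hf c) _).trans (hL c)
  induction V generalizing j with
  | nil => simp [gap]
  | cons c V ih =>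
    rw [List.flatMap_cons, List.drop_append]
    by_cases hj : (f c).length ≤ j
    · rw [List.drop_of_length_le hj, List.nil_append]
      exact ih _
    · rw [show j - (f c).length = 0 by omega, List.drop_zero]
      refine (gap_append_le _ _).trans ?_
      have h1 := h0 V
      have h2 := hL c
      rw [List.length_drop]
      omega

/-- Starting at a left endpoint, one crosses only intervals other than `a`, each of length at most
`M`, and stops before the first `a`. -/
theorem Tiles.sub_le_gap {D : A → ℝ → Prop} {v : A → ℝ} {Λ M : ℝ} {U : Set ℝ}
    (hv : ∀ c, 0 < v c) (hM : ∀ c, c ≠ a → v c ≤ M)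
    (hU : ∀ x, D a x → x ∈ U) {W : List A} {x y : ℝ} (h : Tiles D v Λ x W)
    (hxy : x ≤ y) (hy : y < Λ) (hJ : ∀ z, x ≤ z → z ≤ y → z ∉ U) : y - x ≤ gap a W * M := by
  induction W generalizing x with
  | nil =>
    rw [Tiles] at h
    linarith
  | cons c W ih =>
    obtain ⟨hc, hW⟩ := h
    have hca : c ≠ a := by
      rintro rfl
      exact hJ x le_rfl hxy (hU x hc)
    have hcM := hM c hca
    have hM0 : 0 < M := (hv c).trans_le hcM
    rw [gap_cons_of_ne hca, Nat.cast_succ, add_mul, one_mul]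
    by_cases hyc : y < x + v c
    · have : 0 ≤ gap a W * M := by positivity
      linarith
    · have := ih hW (not_lt.1 hyc) fun z hz => hJ z (by linarith [hv c])
      linarith

/-- Two points which no interval of type `a` separates are close to each other. -/
theorem Tiles.sub_le {D : A → ℝ → Prop} {v : A → ℝ} {Λ M : ℝ} {U : Set ℝ} {N : ℕ}
    (hv : ∀ c, 0 < v c) (hM0 : 0 ≤ M) (hM : ∀ c, c ≠ a → v c ≤ M)
    (hU : ∀ x, D a x → ∀ z, x ≤ z → z < x + v a → z ∈ U) {W : List A}
    (hN : ∀ j, gap a (W.drop j) ≤ N) {x y z : ℝ} (h : Tiles D v Λ x W) (hxy : x ≤ y) (hyz : y ≤ z)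
    (hz : z < Λ) (hJ : ∀ t, y ≤ t → t ≤ z → t ∉ U) : z - y ≤ N * M := by
  induction W generalizing x with
  | nil =>
    rw [Tiles] at h
    linarith
  | cons c W ih =>
    obtain ⟨hc, hW⟩ := h
    by_cases hyc : y < x + v c
    · have hca : c ≠ a := by
        rintro rfl
        exact hJ y le_rfl hyz (hU x hc y hxy hyc)
      -- The interval containing `y` counts as one letter of the gap.
      have hgap := hN 0
      rw [List.drop_zero, gap_cons_of_ne hca] at hgap
      have hgap' : ((gap a W : ℝ) + 1) * M ≤ N * M :=
        mul_le_mul_of_nonneg_right (by exact_mod_cast hgap) hM0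
      have hcM := hM c hca
      by_cases hzc : z < x + v c
      · have : 0 ≤ gap a W * M := by positivity
        linarith
      · have := hW.sub_le_gap hv hM (fun x hx => hU x hx x le_rfl (by linarith [hv a]))
          (not_lt.1 hzc) hz fun t ht => hJ t (by linarith)
        linarith
    · exact ih (fun j => hN (j + 1)) hW (not_lt.1 hyc)

end Words

theorem reduceVec_smul {A : Type*} [DecidableEq A] (w l : A) (t : ℝ) (v : A → ℝ) :
    reduceVec w l (t • v) = t • reduceVec w l v := by
  ext c
  by_cases hc : c = w
  · rw [hc, Pi.smul_apply, reduceVec_self, reduceVec_self]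
    simp [mul_sub]
  · rw [Pi.smul_apply, reduceVec_of_ne hc, reduceVec_of_ne hc, Pi.smul_apply]

variable {A : Type*} [Fintype A] [DecidableEq A] [Nontrivial A]

/-- The definition adds older steps in front; forward induction instead adds the newest step, which
subdivides last. -/
theorem backWord_succ (x : PermPair A × (A → ℝ)) (k : ℕ) (c : A) :
    backWord x (k + 1) c = (backWord (back x) k c).flatMap (stepWord x) := by
  induction k generalizing c with
  | zero => simp [backWord]
  | succ k ih =>
    have h : backWord x (k + 1) = fun c => (backWord (back x) k c).flatMap (stepWord x) :=
      funext ih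
    rw [backWord, h, backWord, List.flatMap_assoc, Function.iterate_succ_apply]

/-- The towers over the intervals exchanged by the `n`-th induced transformation. -/
theorem exists_isTower {p : PermPair A} {lam tau : A → ℝ} (hlam : ∀ c, 0 < lam c)
    (htau : tau ∈ Theta p) (n : ℕ) (hn : IterDefined n ⟨p, lam, tau⟩) :
    (rauzyVeech^[n] ⟨p, lam, tau⟩).tau ∈ Theta (rauzyVeech^[n] ⟨p, lam, tau⟩).perm ∧
    ∃ q W, IsTower (iet p lam) (∑ a, lam a) (rauzyVeech^[n] ⟨p, lam, tau⟩).perm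
        (rauzyVeech^[n] ⟨p, lam, tau⟩).lam q W ∧
      W.length ≤ Fintype.card A * 2 ^ n ∧ (∀ a, a ∈ W) ∧
      ∀ k ≤ n, ∃ V : List A, W = V.flatMap (backWord
        ((rauzyVeech^[n] ⟨p, lam, tau⟩).perm, (rauzyVeech^[n] ⟨p, lam, tau⟩).tau) k) := by
  induction n with
  | zero =>
    refine ⟨htau, _, _, isTower_iet hlam, by simp,
      fun a => List.mem_ofFn.2 (p.top.symm.surjective a), fun k hk => ⟨List.ofFn p.top.symm, ?_⟩⟩
    obtain rfl : k = 0 := by omega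
    exact (List.flatMap_singleton' _).symm
  | succ n ih =>
    obtain ⟨ht, q, W, hT, hlen, hmem, hW⟩ := ih fun k hk => hn k (by omega)
    obtain ⟨h1, h2, h3⟩ := rauzyVeech_spec hT.pos (hn n (by omega)) ht
    rw [Function.iterate_succ_apply']
    refine ⟨h3, _, _, hT.step h1, ?_, fun a => ?_, fun k hk => ?_⟩
    · refine (length_flatMap_le (L := 2) (fun c => ?_) W).trans ?_
      · split_ifs <;> simp
      · rw [pow_succ, ← mul_assoc]
        exact Nat.mul_le_mul_right _ hlen
    · refine List.mem_flatMap.2 ⟨a, hmem a, ?_⟩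
      split_ifs <;> simp
    · cases k with
      | zero => exact ⟨_, (List.flatMap_singleton' _).symm⟩
      | succ k =>
        obtain ⟨V, hV⟩ := hW k (by omega)
        refine ⟨V, ?_⟩
        rw [← h2] at hV
        rw [hV, List.flatMap_assoc, funext (backWord_succ _ k)]
        rfl

/-- At positive times before `q a`, the left endpoint alone shows that the image is not contained in
the base. -/
theorem IsTower.towerHeight_eq {s : SurfaceData A} {n : ℕ} {q : A → ℕ} {W : List A} {Λ : ℝ}
    (h : IsTower (iet s.perm s.lam) Λ (rauzyVeech^[n] s).perm (rauzyVeech^[n] s).lam q W) (a : A) :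
    towerHeight n s a = q a := by
  have hne : rowSum (rauzyVeech^[n] s).perm.top (rauzyVeech^[n] s).lam a ∈
      exchInterval (rauzyVeech^[n] s).perm (rauzyVeech^[n] s).lam a :=
    mem_exchInterval.2 ⟨le_rfl, by linarith [h.pos a]⟩
  apply le_antisymm
  · refine Nat.sInf_le ⟨h.q_pos a, ?_⟩
    rintro _ ⟨y, hy, rfl⟩
    rw [h.return_eq a y hy]
    exact iet_mem_baseInterval h.pos hy
  · refine le_csInf ⟨q a, h.q_pos a, ?_⟩ ?_
    · rintro _ ⟨y, hy, rfl⟩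
      rw [h.return_eq a y hy]
      exact iet_mem_baseInterval h.pos hy
    · rintro k ⟨hk, hk'⟩
      by_contra hlt
      exact h.not_mem a k hk (not_le.1 hlt) _ hne (hk' ⟨_, hne, rfl⟩)

theorem rauzyVeech_smul (P : PermPair A) (v u : A → ℝ) {t : ℝ} (ht : 0 < t) (r : ℝ) :
    rauzyVeech ⟨P, t • v, r • u⟩ = ⟨(rauzyVeech ⟨P, v, u⟩).perm, t • (rauzyVeech ⟨P, v, u⟩).lam,
      r • (rauzyVeech ⟨P, v, u⟩).tau⟩ := by
  simp only [rauzyVeech, Pi.smul_apply, smul_eq_mul, mul_lt_mul_iff_right₀ ht]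
  split_ifs <;> simp only [reduceVec_smul]

/-- The renormalized orbit is a rescaling of the orbit, which is also a rescaling of the orbit of
rescaled suspension data. -/
theorem exists_renorm_iterate_eq {s : SurfaceData A} {n : ℕ}
    (h : ∀ k ≤ n, ∀ c, 0 < (rauzyVeech^[k] s).lam c) :
    ∃ t : ℝ, 0 < t ∧ renorm^[n] s = ⟨(rauzyVeech^[n] s).perm, t⁻¹ • (rauzyVeech^[n] s).lam,
      t • (rauzyVeech^[n] s).tau⟩ := by
  induction n with
  | zero => exact ⟨1, one_pos, by simp⟩
  | succ n ih =>
    obtain ⟨t, ht, ih⟩ := ih fun k hk => h k (by omega)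
    have hpos : 0 < ∑ a, (rauzyVeech^[n + 1] s).lam a :=
      Finset.sum_pos (fun c _ => h (n + 1) le_rfl c) Finset.univ_nonempty
    refine ⟨∑ a, (rauzyVeech^[n + 1] s).lam a, hpos, ?_⟩
    rw [Function.iterate_succ_apply', ih, renorm, rauzyVeech_smul _ _ _ (inv_pos.2 ht)]
    rw [Function.iterate_succ_apply'] at hpos ⊢
    have e : ∀ r : SurfaceData A, (⟨r.perm, r.lam, r.tau⟩ : SurfaceData A) = r := fun _ => rfl
    simp only [e, Pi.smul_apply, smul_eq_mul, ← Finset.mul_sum, smul_smul]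
    congr 2
    · field_simp
    · field_simp

theorem rauzyVeech_iterate_smul (P : PermPair A) (v u : A → ℝ) (r : ℝ) (n : ℕ) :
    rauzyVeech^[n] ⟨P, v, r • u⟩ = ⟨(rauzyVeech^[n] ⟨P, v, u⟩).perm,
      (rauzyVeech^[n] ⟨P, v, u⟩).lam, r • (rauzyVeech^[n] ⟨P, v, u⟩).tau⟩ := by
  induction n with
  | zero => rfl
  | succ n ih =>
    rw [Function.iterate_succ_apply', ih, Function.iterate_succ_apply']
    have := rauzyVeech_smul (rauzyVeech^[n] ⟨P, v, u⟩).perm (rauzyVeech^[n] ⟨P, v, u⟩).lam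
      (rauzyVeech^[n] ⟨P, v, u⟩).tau one_pos r
    rwa [one_smul, one_smul] at this

/-- If every two points of `[0, Λ)` which are not separated by a point of one of the finitely
many sets `E i` are at distance at most `B`, then some `E i` is close to `0`, and some is close
to `Λ`. -/
theorem iInf_infDist_le {Λ B : ℝ} (hB : 0 ≤ B) {q : ℕ} {E : ℕ → Set ℝ}
    (hE : ∃ i < q, ∃ z ∈ E i, 0 ≤ z ∧ z < Λ)
    (h : ∀ y z, 0 ≤ y → y ≤ z → z < Λ → (∀ t, y ≤ t → t ≤ z → ∀ i < q, t ∉ E i) → z - y ≤ B) :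
    (⨅ i : Fin q, Metric.infDist 0 (E i)) ≤ B ∧ (⨅ i : Fin q, Metric.infDist Λ (E i)) ≤ B := by
  have hbdd : ∀ x : ℝ, BddBelow (Set.range fun i : Fin q => Metric.infDist x (E i)) := fun x =>
    ⟨0, by rintro _ ⟨i, rfl⟩; exact Metric.infDist_nonneg⟩
  have hle : ∀ x : ℝ, ∀ i < q, ∀ z ∈ E i, (⨅ i : Fin q, Metric.infDist x (E i)) ≤ |x - z| := by
    intro x i hi z hz
    exact (ciInf_le (hbdd x) ⟨i, hi⟩).trans (Metric.infDist_le_dist_of_mem hz)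
  obtain ⟨i0, hi0, z0, hz0, hz1, hz2⟩ := hE
  have hΛ : 0 < Λ := hz1.trans_lt hz2
  constructor
  · refine le_of_forall_pos_le_add fun ε hε => ?_
    by_contra! hlt
    have hz := hle 0 i0 hi0 z0 hz0
    rw [zero_sub, abs_neg, abs_of_nonneg hz1] at hz
    have := h 0 (B + ε) le_rfl (by linarith) (by linarith) (fun t ht0 ht i hi hti => by
      have := hle 0 i hi t hti
      rw [zero_sub, abs_neg, abs_of_nonneg ht0] at this
      linarith)
    linarith
  · refine le_of_forall_pos_le_add fun ε hε => ?_
    by_contra! hlt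
    have hz := hle Λ i0 hi0 z0 hz0
    rw [abs_of_nonneg (by linarith)] at hz
    -- The point `Λ` is outside the domain, so the right end of the test segment is moved in by `ε /
    -- 2`; its length still exceeds `B`.
    have := h (Λ - (B + ε)) (Λ - ε / 2) (by linarith) (by linarith) (by linarith)
      (fun t ht0 ht i hi hti => by
        have := hle Λ i hi t hti
        rw [abs_of_nonneg (by linarith)] at this
        linarith)
    linarith

end IETSpacing

end

/-! ### The spacing estimates and the conclusion -/

noncomputable section

open Topology

namespace IETSpacing

variable {A : Type*} [Fintype A] [DecidableEq A] [Nontrivial A]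

theorem le_maxOther (n : ℕ) (s : SurfaceData A) {a b : A} (h : b ≠ a) :
    (rauzyVeech^[n] s).lam b ≤ maxOther n s a :=
  le_ciSup (f := fun b : {b : A // b ≠ a} => (rauzyVeech^[n] s).lam b)
    (Set.finite_range _).bddAbove ⟨b, h⟩

/-- A bound for the gaps between the letters `a` in the order of the levels bounds the gaps
between the levels of the tower over `a`. -/
theorem IsTower.spacing {p : PermPair A} {lam tau : A → ℝ} {n : ℕ} {q : A → ℕ} {W : List A}
    (h : IsTower (iet p lam) (∑ b, lam b) (rauzyVeech^[n] ⟨p, lam, tau⟩).perm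
      (rauzyVeech^[n] ⟨p, lam, tau⟩).lam q W) {a : A} {N : ℕ}
    (hN : ∀ j, gap a (W.drop j) ≤ N) {C : ℝ} (hC : N < C) (ha : a ∈ W) :
    (∀ J : Set ℝ, J.OrdConnected →
      J ⊆ baseInterval lam \ ⋃ i < towerHeight n ⟨p, lam, tau⟩ a,
        towerLevel n ⟨p, lam, tau⟩ a i →
      MeasureTheory.volume.real J < C * maxOther n ⟨p, lam, tau⟩ a) ∧
    max
      (⨅ i : Fin (towerHeight n ⟨p, lam, tau⟩ a),
        Metric.infDist 0 (towerLevel n ⟨p, lam, tau⟩ a i))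
      (⨅ i : Fin (towerHeight n ⟨p, lam, tau⟩ a),
        Metric.infDist (∑ b, lam b) (towerLevel n ⟨p, lam, tau⟩ a i)) <
      C * maxOther n ⟨p, lam, tau⟩ a := by
  obtain ⟨b, hb⟩ := exists_ne a
  have hM0 : 0 < maxOther n ⟨p, lam, tau⟩ a := (h.pos b).trans_le (le_maxOther n _ hb)
  have hq : towerHeight n ⟨p, lam, tau⟩ a = q a := IsTower.towerHeight_eq (s := ⟨p, lam, tau⟩) h a
  rw [hq]
  have hlevel : ∀ x, IsLevel (iet p lam) (rauzyVeech^[n] ⟨p, lam, tau⟩).perm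
      (rauzyVeech^[n] ⟨p, lam, tau⟩).lam q a x → ∃ i < q a, ∀ z, x ≤ z →
        z < x + (rauzyVeech^[n] ⟨p, lam, tau⟩).lam a → z ∈ towerLevel n ⟨p, lam, tau⟩ a i := by
    rintro x ⟨i, hi, hx⟩
    refine ⟨i, hi, fun z hz hz' => ?_⟩
    have hy : z - x + rowSum (rauzyVeech^[n] ⟨p, lam, tau⟩).perm.top
        (rauzyVeech^[n] ⟨p, lam, tau⟩).lam a ∈ towerBase n ⟨p, lam, tau⟩ a :=
      mem_exchInterval.2 ⟨by linarith, by linarith⟩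
    refine ⟨_, hy, ?_⟩
    change (iet p lam)^[i] _ = z
    rw [hx _ hy]
    ring
  have hpair : ∀ y z, 0 ≤ y → y ≤ z → z < ∑ b, lam b →
      (∀ t, y ≤ t → t ≤ z → ∀ i < q a, t ∉ towerLevel n ⟨p, lam, tau⟩ a i) →
      z - y ≤ N * maxOther n ⟨p, lam, tau⟩ a := by
    intro y z hy hyz hz ht
    refine h.tiles.sub_le (a := a)
      (U := {t | ∃ i < q a, t ∈ towerLevel n ⟨p, lam, tau⟩ a i}) h.pos hM0.le
      (fun c hc => le_maxOther n _ hc) (fun x hx t h1 h2 => ?_) hN hy hyz hz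
      fun t h1 h2 ⟨i, hi, hti⟩ => ht t h1 h2 i hi hti
    obtain ⟨i, hi, hxi⟩ := hlevel x hx
    exact ⟨i, hi, hxi t h1 h2⟩
  have hlt : N * maxOther n ⟨p, lam, tau⟩ a < C * maxOther n ⟨p, lam, tau⟩ a :=
    mul_lt_mul_of_pos_right hC hM0
  have hB : 0 ≤ N * maxOther n ⟨p, lam, tau⟩ a := by positivity
  constructor
  · intro J hJ hJsub
    refine lt_of_le_of_lt ?_ hlt
    refine ENNReal.toReal_le_of_le_ofReal hB ((Real.volume_le_diam J).trans ?_)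
    have key : ∀ y ∈ J, ∀ z ∈ J, y ≤ z → z - y ≤ N * maxOther n ⟨p, lam, tau⟩ a := by
      intro y hy z hz hyz
      refine hpair y z (hJsub hy).1.1 hyz (hJsub hz).1.2 fun t h1 h2 i hi hti => ?_
      exact (hJsub (hJ.out hy hz ⟨h1, h2⟩)).2 (Set.mem_iUnion₂.2 ⟨i, hi, hti⟩)
    refine Metric.ediam_le fun y hy z hz => ?_
    rw [edist_dist, Real.dist_eq]
    refine ENNReal.ofReal_le_ofReal (abs_le.2 ⟨?_, ?_⟩)
    · rcases le_total y z with hyz | hyz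
      · linarith [key y hy z hz hyz]
      · linarith
    · rcases le_total y z with hyz | hyz
      · linarith
      · linarith [key z hz y hy hyz]
  · obtain ⟨x, hx0, hxlt, hx⟩ := h.tiles.exists_of_mem h.pos ha
    obtain ⟨i, hi, hxi⟩ := hlevel x hx
    have := iInf_infDist_le (E := towerLevel n ⟨p, lam, tau⟩ a) hB
      ⟨i, hi, x, hxi x le_rfl (by linarith [h.pos a]), hx0, hxlt⟩ hpair
    exact (max_le this.1 this.2).trans_lt hlt

end IETSpacing

end

theorem mainTheorem9 {A : Type*} [Fintype A] [DecidableEq A] [Nontrivial A]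
    (p : IETSpacing.PermPair A) (hp : p.Irreducible)
    (tau0 : A → ℝ) (htau0 : tau0 ∈ IETSpacing.Theta p) (hind : LinearIndependent ℚ tau0) :
    ∃ ε : ℝ, 0 < ε ∧ ∃ C : ℝ, 0 < C ∧
      ∀ lam : A → ℝ, (∀ a, 0 < lam a) →
      ∀ tau ∈ IETSpacing.Theta p,
      ∀ n : ℕ, IETSpacing.IterDefined n ⟨p, lam, tau⟩ →
        (IETSpacing.renorm^[n] ⟨p, lam, tau⟩).perm = p →
        (IETSpacing.renorm^[n] ⟨p, lam, tau⟩).tau ∈ Metric.ball tau0 ε ∩ IETSpacing.Theta p →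
        ∀ a : A,
          (∀ J : Set ℝ, J.OrdConnected →
            J ⊆ IETSpacing.baseInterval lam \
              ⋃ i < IETSpacing.towerHeight n ⟨p, lam, tau⟩ a,
                IETSpacing.towerLevel n ⟨p, lam, tau⟩ a i →
            MeasureTheory.volume.real J < C * IETSpacing.maxOther n ⟨p, lam, tau⟩ a) ∧
          max
            (⨅ i : Fin (IETSpacing.towerHeight n ⟨p, lam, tau⟩ a),
              Metric.infDist 0 (IETSpacing.towerLevel n ⟨p, lam, tau⟩ a i))
            (⨅ i : Fin (IETSpacing.towerHeight n ⟨p, lam, tau⟩ a),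
              Metric.infDist (∑ b, lam b) (IETSpacing.towerLevel n ⟨p, lam, tau⟩ a i)) <
            C * IETSpacing.maxOther n ⟨p, lam, tau⟩ a := by
  open IETSpacing in
  obtain ⟨m, hm⟩ := exists_backWord_full (x := (p, tau0)) htau0 hind
  obtain ⟨ε, hε, hball⟩ := Metric.eventually_nhds_iff_ball.1 (eventually_backWord_eq htau0 hind m)
  -- The two summands bound the gaps for `n ≥ m` and for `n ≤ m`; the final `1` makes the
  -- inequalities strict.
  refine ⟨ε, hε, ((2 * 2 ^ m + Fintype.card A * 2 ^ m : ℕ) : ℝ) + 1, by positivity, ?_⟩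
  intro lam hlam tau htau n hn hperm htaun a
  have hpos : ∀ k ≤ n, ∀ c, 0 < (rauzyVeech^[k] ⟨p, lam, tau⟩).lam c := fun k hk => by
    obtain ⟨-, q, W, hT, -⟩ := exists_isTower hlam htau k fun j hj => hn j (by omega)
    exact hT.pos
  obtain ⟨t, ht, hren⟩ := exists_renorm_iterate_eq hpos
  simp only [hren] at hperm htaun
  -- The renormalized suspension vector is the `n`-th one in the unnormalized orbit of `t • tau`,
  -- with the same `lam` and hence the same towers.
  have hiter := rauzyVeech_iterate_smul p lam tau t
  have hn' : IterDefined n ⟨p, lam, t • tau⟩ := fun k hk => by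
    rw [hiter k]
    exact hn k hk
  obtain ⟨-, q, W, hT, hlen, hmem, hW⟩ := exists_isTower hlam (smul_mem_Theta htau ht) n hn'
  rw [hiter n] at hT hW
  have hT' : IsTower (iet p lam) (∑ b, lam b) (rauzyVeech^[n] ⟨p, lam, tau⟩).perm
    (rauzyVeech^[n] ⟨p, lam, tau⟩).lam q W := hT
  refine hT'.spacing (fun j => ?_) (lt_add_one _) (hmem a)
  rcases le_total m n with h | h
  · obtain ⟨V, hV⟩ := hW m h
    have hword := hball _ htaun.1
    simp only [hperm] at hV
    rw [hV, hword]
    exact (gap_drop_flatMap_le (hm a) (backWord_length_le _ m) V j).trans (Nat.le_add_right _ _)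
  · refine (gap_le_length _).trans ?_
    rw [List.length_drop]
    have : Fintype.card A * 2 ^ n ≤ Fintype.card A * 2 ^ m :=
      Nat.mul_le_mul_left _ (Nat.pow_le_pow_right two_pos h)
    omega
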